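/- Let $n\ge 2$, let $I\subseteq\mathbb R$ be a nonempty open interval and let $\alpha:I\to\mathbb R^n$. Call $\alpha$ a Frenet curve if it is of class $C^n$ and $\alpha'(t),\dots,\alpha^{(n-1)}(t)$ are linearly independent for every $t\in I$. Its Frenet frame $e_1,\dots,e_n$ is then obtained by applying the Gram–Schmidt process to $\alpha',\dots,\alpha^{(n-1)}$ and adding the unit vector $e_n$ that makes $(e_1,\dots,e_n)$ a positively oriented orthonormal basis; its curvatures are $k_i=\langle e_i',e_{i+1}\rangle/\|\alpha'\|$, $1\le i\le n-1$. It is called twisted if $k_{n-1}(t)\neq 0$ for every $t\in I$. A geodesic on a flat torus in $\mathbb R^{2k}$ is a curve of the form $$\gamma(s)=\bigl(r_1\cos(m_1s+c_1),\,r_1\sin(m_1s+c_1),\dots,r_k\cos(m_ks+c_k),\,r_k\sin(m_ks+c_k)\bigr),\qquad s\in\mathbb R,$$ with constants $r_l>0$ and $m_l,c_l\in\mathbb R$. Then $\alpha$ is a twisted Frenet curve all of whose curvatures $k_1,\dots,k_{n-1}$ are constant if and only if, up to an isometry of $\mathbb R^n$ and a change of parameter, it is one of the following, that is, if and only if there are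 an isometry $A$ of $\mathbb R^n$ and a $C^n$ function $\varphi:I\to\mathbb R$ with $\varphi'>0$ such that $\alpha(t)=A(\beta(\varphi(t)))$ for all $t\in I$, where 1. if $n=2k$ is even, $\beta=\gamma$ is a twisted geodesic on a flat torus in $\mathbb R^{2k}$; 2. if $n=2k+1$ is odd, $\beta(s)=(\gamma(s),\,a s)$, with $\gamma$ a twisted geodesic on a flat torus in $\mathbb R^{2k}$ (twisted as a curve in $\mathbb R^{2k}$) and $a\ne 0$ a real constant. -/

import Mathlib

noncomputable section

/-- The `i`-th vector (`i = 0, …, n - 1`) of the moving Frenet frame of a curve `α` in `ℝⁿ`.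
The first `n - 1` vectors come from the Gram-Schmidt process applied to `α'(t), α''(t), …`
(the `i`-th output depends only on the first `i + 1` derivatives). The last one is the vector
representing the linear form `v ↦ det (e₀, …, e_{n-2}, v)`, that is, the unit vector which
completes them to a positively oriented orthonormal basis. -/
def frenetVector {n : ℕ} (α : ℝ → EuclideanSpace ℝ (Fin n)) (i : ℕ) (t : ℝ) :
    EuclideanSpace ℝ (Fin n) :=
  let e : ℕ → EuclideanSpace ℝ (Fin n) :=
    InnerProductSpace.gramSchmidtNormed ℝ (fun j : ℕ => iteratedDeriv (j + 1) α t)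
  if i + 1 < n then e i
  else WithLp.toLp 2 (fun c : Fin n =>
    Matrix.det (Matrix.of fun a b : Fin n =>
      if (a : ℕ) + 1 < n then e a b else if b = c then 1 else 0))

/-- The curvatures of a curve in `ℝⁿ`, numbered from `0`: `frenetCurvature α i`, for
`i = 0, …, n - 2`, is the curvature usually called `k_{i+1}`. -/
def frenetCurvature {n : ℕ} (α : ℝ → EuclideanSpace ℝ (Fin n)) (i : ℕ) (t : ℝ) : ℝ :=
  inner ℝ (deriv (frenetVector α i) t) (frenetVector α (i + 1) t) / ‖deriv α t‖

/-- `α` is a curve on the open interval `I` whose Frenet frame and curvatures are defined: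
it is of class `C^n`, and its derivatives of order `1, …, n - 1` are linearly independent. -/
def IsFrenetCurve {n : ℕ} (α : ℝ → EuclideanSpace ℝ (Fin n)) (I : Set ℝ) : Prop :=
  ContDiffOn ℝ n α I ∧
    ∀ t ∈ I, LinearIndependent ℝ (fun j : Fin (n - 1) => iteratedDeriv ((j : ℕ) + 1) α t)

/-- A curve in `ℝⁿ`, `n ≥ 2`, is twisted if its last curvature `k_{n-1}` does not vanish. -/
def IsTwistedCurve {n : ℕ} (α : ℝ → EuclideanSpace ℝ (Fin n)) (I : Set ℝ) : Prop :=
  IsFrenetCurve α I ∧ ∀ t ∈ I, frenetCurvature α (n - 2) t ≠ 0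

/-- All the curvatures `k₁, …, k_{n-1}` are constant on `I`. -/
def HasConstantCurvatures {n : ℕ} (α : ℝ → EuclideanSpace ℝ (Fin n)) (I : Set ℝ) : Prop :=
  ∀ i : ℕ, i + 1 < n → ∃ c : ℝ, ∀ t ∈ I, frenetCurvature α i t = c

/-- The parametrization
`u ↦ (r₁ cos u₁, r₁ sin u₁, …, r_k cos u_k, r_k sin u_k)` of a flat torus in `ℝ^{2k}`. -/
def flatTorus {k : ℕ} (r u : Fin k → ℝ) : EuclideanSpace ℝ (Fin (2 * k)) :=
  WithLp.toLp 2 (fun j : Fin (2 * k) =>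
    if (j : ℕ) % 2 = 0 then r ⟨(j : ℕ) / 2, by omega⟩ * Real.cos (u ⟨(j : ℕ) / 2, by omega⟩)
    else r ⟨(j : ℕ) / 2, by omega⟩ * Real.sin (u ⟨(j : ℕ) / 2, by omega⟩))

/-- A geodesic on a flat torus with radii `r_l > 0`. The induced metric in the parameters `u`
is `∑ r_l² du_l²`, so the geodesics are the images of the straight lines `u_l = m_l t + c_l`. -/
def IsFlatTorusGeodesic {k : ℕ} (γ : ℝ → EuclideanSpace ℝ (Fin (2 * k))) : Prop :=
  ∃ r m c : Fin k → ℝ, (∀ l, 0 < r l) ∧ ∀ t : ℝ, γ t = flatTorus r (fun l => m l * t + c l)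

/-- The curve `t ↦ (γ(t), a t)` with one more coordinate, a linear function of the parameter. -/
def timesLinear {d : ℕ} (γ : ℝ → EuclideanSpace ℝ (Fin d)) (a : ℝ) (t : ℝ) :
    EuclideanSpace ℝ (Fin (d + 1)) :=
  WithLp.toLp 2 (Fin.snoc (α := fun _ => ℝ) (fun j : Fin d => γ t j) (a * t))

/-- On `I`, the curve `α` is `β` up to an isometry of `ℝⁿ` and a regular `C^n` change of
parameter. -/
def IsCongruentReparam {n : ℕ} (α β : ℝ → EuclideanSpace ℝ (Fin n)) (I : Set ℝ) : Prop :=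
  ∃ (A : EuclideanSpace ℝ (Fin n) ≃ᵃⁱ[ℝ] EuclideanSpace ℝ (Fin n)) (φ : ℝ → ℝ),
    ContDiffOn ℝ n φ I ∧ (∀ t ∈ I, 0 < deriv φ t) ∧ ∀ t ∈ I, α t = A (β (φ t))

end

/-! Curvatures determine the motion of the Frenet frame: with speed `w`, the frame solves `e_i' = w
∑ K_ij e_j`, where `K` is skew and tridiagonal. If the curvatures are constant, `K` is a constant
skew map `T`, written in the frame at a base point `t₀`. Let `L t` carry the frame at `t₀` to the
frame at `t`; then `(L t x)' = w • L t (T x)`. Twistedness makes every superdiagonal entry of `K`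
nonzero, so the first frame vector is cyclic for `T`. A skew map with a cyclic vector rotates
orthogonal planes with distinct positive speeds `m l`, one plane for each speed, and has a kernel of
dimension at most one, spanned by the kernel component `v₀` of that vector
(`exists_skew_normal_form`). In arc length `φ`, the plane `l` turns by the angle `m l * φ` and `v₀`
stays fixed. Integrating the tangent gives circles in the planes plus the drift `φ • v₀`
(`IsTwistedCurve.exists_explicit_form`). Parity of the dimension decides whether `v₀` vanishes.
Distinct positive speeds make the torus geodesic twisted, by counting the roots of a polynomial
(`isTwistedCurve_flatTorus`).

Conversely, the velocity of a torus geodesic, or of its product with a linear coordinate, solves `x'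
= R x` with `R` skew. Gram–Schmidt commutes with the flow of `R`, so the frame solves the same
equation and the curvatures are constant (`IsFrenetCurve.hasConstantCurvatures_of_skew`). Invariance
under isometry and reparametrization follows by transporting the frame: a frame solving Frenet
equations is the Frenet frame up to the sign of its last vector (`FrenetSystem.frenetCurvature_eq`).
Twistedness is tested on derivatives alone through `isTwistedCurve_iff`. -/

section

open InnerProductSpace

/-! ### Gram–Schmidt frames and their characterization by triangularity. -/

section Frame

variable {n : ℕ}

/-- The frame built from a sequence of vectors of `ℝⁿ`: Gram-Schmidt, completed by the
generalized cross product. -/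
noncomputable def frameOf (D : ℕ → EuclideanSpace ℝ (Fin n)) (i : ℕ) : EuclideanSpace ℝ (Fin n) :=
  if i + 1 < n then gramSchmidtNormed ℝ D i
  else WithLp.toLp 2 (fun c : Fin n =>
    Matrix.det (Matrix.of fun a b : Fin n =>
      if (a : ℕ) + 1 < n then gramSchmidtNormed ℝ D a b else if b = c then 1 else 0))

theorem frenetVector_eq_frameOf (α : ℝ → EuclideanSpace ℝ (Fin n)) (i : ℕ) (t : ℝ) :
    frenetVector α i t = frameOf (fun j => iteratedDeriv (j + 1) α t) i := rfl

/-- The generalized cross product of `e 0, …, e (n - 2)`. -/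
noncomputable def crossVector (e : ℕ → EuclideanSpace ℝ (Fin n)) : EuclideanSpace ℝ (Fin n) :=
  WithLp.toLp 2 (fun c : Fin n =>
    Matrix.det (Matrix.of fun a b : Fin n =>
      if (a : ℕ) + 1 < n then e a b else if b = c then 1 else 0))

theorem frameOf_of_lt (D : ℕ → EuclideanSpace ℝ (Fin n)) {i : ℕ} (hi : i + 1 < n) :
    frameOf D i = gramSchmidtNormed ℝ D i := if_pos hi

theorem frameOf_of_not_lt (D : ℕ → EuclideanSpace ℝ (Fin n)) {i : ℕ} (hi : ¬ i + 1 < n) :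
    frameOf D i = crossVector (gramSchmidtNormed ℝ D) := if_neg hi

theorem crossVector_congr {e f : ℕ → EuclideanSpace ℝ (Fin n)}
    (h : ∀ i, i + 1 < n → e i = f i) : crossVector e = crossVector f := by
  unfold crossVector
  congr 1
  funext c
  congr 2
  funext a b
  split_ifs with ha
  · rw [h a ha]
  · rfl
  · rfl

/-- A determinant is linear in its last row, so expanding `v` in the standard basis gives the
pairing. -/
theorem inner_crossVector (hn : 1 ≤ n) (e : ℕ → EuclideanSpace ℝ (Fin n))
    (v : EuclideanSpace ℝ (Fin n)) :
    inner ℝ v (crossVector e) = Matrix.det (Matrix.of fun a b : Fin n =>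
      if (a : ℕ) + 1 < n then e a b else v b) := by
  set l : Fin n := ⟨n - 1, by omega⟩ with hl
  set M : Fin n → Fin n → ℝ := fun a b => e a b with hM
  have key : ∀ w : Fin n → ℝ, (Matrix.of fun a b : Fin n =>
      if (a : ℕ) + 1 < n then e a b else w b) = Function.update M l w := by
    intro w
    ext a b
    rcases eq_or_ne a l with rfl | hne
    · have : ¬ (n - 1 + 1 < n) := by omega
      simp [hl, this]
    · have : (a : ℕ) + 1 < n := by
        have h1 : (a : ℕ) ≠ n - 1 := fun h => hne (Fin.ext h)
        have := a.2
        omega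
      simp [hne, this, hM]
  rw [key]
  have := LinearMap.pi_apply_eq_sum_univ
    ((Matrix.detRowAlternating (n := Fin n) (R := ℝ)).toMultilinearMap.toLinearMap M l) v
  simp only [MultilinearMap.toLinearMap_apply, AlternatingMap.coe_multilinearMap] at this
  change Matrix.detRowAlternating _ = _ at this
  rw [show Matrix.det (Function.update M l v : Matrix (Fin n) (Fin n) ℝ)
    = Matrix.detRowAlternating (Function.update M l v) from rfl, this, PiLp.inner_apply]
  refine Finset.sum_congr rfl fun c _ => ?_
  simp only [RCLike.inner_apply, conj_trivial, smul_eq_mul, crossVector, mul_comm (v c)]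
  congr 1
  have hk := key (fun b => if b = c then 1 else 0)
  rw [hk]
  change Matrix.detRowAlternating _ = _
  congr 2
  funext b
  simp [eq_comm]

theorem Orthonormal.inner_nat {f : ℕ → EuclideanSpace ℝ (Fin n)}
    (hf : Orthonormal ℝ (fun i : Fin n => f i)) {i j : ℕ} (hi : i < n) (hj : j < n) :
    inner ℝ (f i) (f j) = if i = j then (1 : ℝ) else 0 := by
  have := orthonormal_iff_ite.1 hf ⟨i, hi⟩ ⟨j, hj⟩
  simpa using this

theorem Orthonormal.eq_sum {f : ℕ → EuclideanSpace ℝ (Fin n)}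
    (hf : Orthonormal ℝ (fun i : Fin n => f i)) (x : EuclideanSpace ℝ (Fin n)) :
    x = ∑ i : Fin n, (inner ℝ (f i) x : ℝ) • f i := by
  rcases Nat.eq_zero_or_pos n with rfl | hn
  · exact Subsingleton.elim _ _
  have : Nonempty (Fin n) := ⟨⟨0, hn⟩⟩
  set b := (basisOfOrthonormalOfCardEqFinrank hf (by simp)).toOrthonormalBasis
    (by simpa using hf) with hb
  have h := b.sum_repr' x
  have hbf : ∀ i : Fin n, b i = f i := fun i => by simp [hb]
  simp only [hbf] at h
  exact h.symm

theorem Orthonormal.eq_of_inner {f : ℕ → EuclideanSpace ℝ (Fin n)}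
    (hf : Orthonormal ℝ (fun i : Fin n => f i)) {x y : EuclideanSpace ℝ (Fin n)}
    (h : ∀ i, i < n → inner ℝ (f i) x = (inner ℝ (f i) y : ℝ)) : x = y := by
  rw [hf.eq_sum x, hf.eq_sum y]
  exact Finset.sum_congr rfl fun i _ => by rw [h i i.2]

/-- Pairing with `f i` puts `f i` in the last row: two rows coincide when `i < n - 1`, and `i = n -
1` leaves the determinant of an orthogonal matrix, which is the sign `ε`. -/
theorem crossVector_eq_of_orthonormal (hn : 1 ≤ n) {f : ℕ → EuclideanSpace ℝ (Fin n)}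
    (hf : Orthonormal ℝ (fun i : Fin n => f i)) :
    ∃ ε : ℝ, ε ^ 2 = 1 ∧ crossVector f = ε • f (n - 1) := by
  set M : Matrix (Fin n) (Fin n) ℝ := Matrix.of fun a b => f a b with hM
  refine ⟨M.det, ?_, ?_⟩
  · have h : M * M.transpose = 1 := by
      ext a b
      rw [Matrix.mul_apply, Matrix.one_apply]
      have := hf.inner_nat b.2 a.2
      rw [PiLp.inner_apply] at this
      simp only [RCLike.inner_apply, conj_trivial] at this
      simp only [hM, Matrix.transpose_apply, Matrix.of_apply, this, Fin.ext_iff, eq_comm]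
    have := congrArg Matrix.det h
    rwa [Matrix.det_mul, Matrix.det_transpose, Matrix.det_one, ← sq] at this
  · refine hf.eq_of_inner fun i hi => ?_
    rw [inner_crossVector hn, inner_smul_right, hf.inner_nat hi (by omega)]
    split_ifs with h
    · subst h
      rw [mul_one]
      congr 1
      ext a b
      simp only [Matrix.of_apply, hM]
      split_ifs with ha
      · rfl
      · have : (a : ℕ) = n - 1 := by have := a.2; omega
        rw [this]
    · rw [mul_zero]
      refine Matrix.det_zero_of_row_eq (i := ⟨i, hi⟩) (j := ⟨n - 1, by omega⟩) (by simpa using h) ?_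
      have h1 : i + 1 < n := by omega
      have h2 : ¬ (n - 1 + 1 < n) := by omega
      ext b
      simp [h1, h2]

/-- Uniqueness of Gram–Schmidt: once the earlier vectors agree with `f`, subtracting the projections
of `D i` leaves only its `f i` component, whose sign is fixed by positivity. No orientation is
imposed on `f`, hence the undetermined sign of the last vector. -/
theorem frameOf_eq_of_triangular (hn : 1 ≤ n) {D f : ℕ → EuclideanSpace ℝ (Fin n)}
    (hf : Orthonormal ℝ (fun i : Fin n => f i))
    (h0 : ∀ j m, j < m → m < n → inner ℝ (D j) (f m) = (0 : ℝ))
    (hpos : ∀ j, j + 1 < n → 0 < (inner ℝ (D j) (f j) : ℝ)) :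
    (∀ i, i + 1 < n → frameOf D i = f i) ∧
      ∃ ε : ℝ, ε ^ 2 = 1 ∧ frameOf D (n - 1) = ε • f (n - 1) := by
  have key : ∀ i, i + 1 < n → gramSchmidtNormed ℝ D i = f i := by
    intro i
    induction i using Nat.strong_induction_on with
    | _ i ih =>
    intro hi
    have hterm : ∀ j ∈ Finset.Iio i, (ℝ ∙ gramSchmidt ℝ D j).starProjection (D i)
        = (inner ℝ (f j) (D i) : ℝ) • f j := by
      intro j hj
      have hj' : j < i := Finset.mem_Iio.1 hj
      have hjn : j + 1 < n := by omega
      have e := ih j hj' hjn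
      have hne : gramSchmidt ℝ D j ≠ 0 := by
        intro h
        have h1 : ‖f j‖ = 1 := hf.1 ⟨j, by omega⟩
        rw [← e, gramSchmidtNormed, h] at h1
        simp at h1
      have hs : (ℝ ∙ gramSchmidt ℝ D j) = ℝ ∙ f j := by
        rw [← e, gramSchmidtNormed]
        exact (Submodule.span_singleton_smul_eq
          (IsUnit.mk0 _ (by simpa using hne)) _).symm
      simp only [hs]
      exact Submodule.starProjection_unit_singleton ℝ (hf.1 ⟨j, by omega⟩) _
    have hgs : gramSchmidt ℝ D i = (inner ℝ (D i) (f i) : ℝ) • f i := by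
      rw [gramSchmidt_def, Finset.sum_congr rfl hterm]
      refine hf.eq_of_inner fun m hm => ?_
      rw [inner_sub_right, inner_sum, inner_smul_right, hf.inner_nat hm (by omega)]
      have : ∀ j ∈ Finset.Iio i, inner ℝ (f m) ((inner ℝ (f j) (D i) : ℝ) • f j)
          = if j = m then (inner ℝ (f m) (D i) : ℝ) else 0 := by
        intro j hj
        have hj' : j < i := Finset.mem_Iio.1 hj
        rw [inner_smul_right, hf.inner_nat hm (by omega)]
        by_cases h : j = m
        · simp [h]
        · simp [h, Ne.symm h]
      rw [Finset.sum_congr rfl this, Finset.sum_ite_eq']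
      rcases lt_trichotomy m i with h | h | h
      · simp [h, h.ne]
      · subst h
        simp [real_inner_comm]
      · simp [h.ne', not_lt.2 h.le, real_inner_comm, h0 i m h hm]
    have h1 : ‖f i‖ = 1 := hf.1 ⟨i, by omega⟩
    have hp := hpos i hi
    rw [gramSchmidtNormed, hgs, norm_smul, h1, mul_one, Real.norm_of_nonneg hp.le, smul_smul]
    simp [hp.ne']
  refine ⟨fun i hi => by rw [frameOf_of_lt D hi, key i hi], ?_⟩
  obtain ⟨ε, h1, h2⟩ := crossVector_eq_of_orthonormal hn hf
  refine ⟨ε, h1, ?_⟩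
  rw [frameOf_of_not_lt D (by omega), crossVector_congr key, h2]

theorem linearIndependent_of_triangular {D f : ℕ → EuclideanSpace ℝ (Fin n)} (m : ℕ)
    (h0 : ∀ i j, i < j → j < m → inner ℝ (D i) (f j) = (0 : ℝ))
    (hne : ∀ j, j < m → (inner ℝ (D j) (f j) : ℝ) ≠ 0) :
    LinearIndependent ℝ (fun j : Fin m => D j) := by
  induction m with
  | zero => exact linearIndependent_empty_type
  | succ m ih =>
    rw [linearIndependent_finSucc']
    refine ⟨ih (fun i j h1 h2 => h0 i j h1 (by omega)) (fun j hj => hne j (by omega)), ?_⟩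
    intro hmem
    have hle : Submodule.span ℝ (Set.range (Fin.init fun j : Fin (m + 1) => D j))
        ≤ LinearMap.ker (innerSL ℝ (f m)).toLinearMap := by
      rw [Submodule.span_le]
      rintro _ ⟨i, rfl⟩
      have := h0 i m i.2 (by omega)
      rw [real_inner_comm] at this
      simpa [Fin.init] using this
    have := hle hmem
    apply hne m (by omega)
    rw [real_inner_comm]
    simpa using this

variable {D : ℕ → EuclideanSpace ℝ (Fin n)}

theorem gramSchmidt_ne_zero_nat {m : ℕ} (h : LinearIndependent ℝ (fun j : Fin m => D j))
    {i : ℕ} (hi : i < m) : gramSchmidt ℝ D i ≠ 0 := by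
  apply gramSchmidt_ne_zero_coe
  exact h.comp (fun j : Set.Iic i => ⟨j, lt_of_le_of_lt j.2 hi⟩)
    (fun a b hab => Subtype.ext (by simpa using hab))

theorem inner_gramSchmidt_eq_zero {i m : ℕ} (him : i < m) :
    inner ℝ (D i) (gramSchmidtNormed ℝ D m) = (0 : ℝ) := by
  rw [real_inner_comm, gramSchmidtNormed, inner_smul_left, gramSchmidt_inv_triangular ℝ D him,
    mul_zero]

theorem inner_gramSchmidtNormed_self (i : ℕ) :
    inner ℝ (D i) (gramSchmidtNormed ℝ D i) = ‖gramSchmidt ℝ D i‖ := by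
  have h : inner ℝ (D i) (gramSchmidt ℝ D i) = ‖gramSchmidt ℝ D i‖ ^ 2 := by
    conv_lhs => rw [gramSchmidt_def'' ℝ D i]
    rw [inner_add_left, sum_inner, Finset.sum_eq_zero, add_zero, real_inner_self_eq_norm_sq]
    intro j hj
    rw [inner_smul_left, gramSchmidt_orthogonal ℝ D (Finset.mem_Iio.1 hj).ne, mul_zero]
  rw [gramSchmidtNormed, inner_smul_right, h]
  by_cases h0 : ‖gramSchmidt ℝ D i‖ = 0
  · simp [h0]
  · simp only [RCLike.ofReal_real_eq_id, id_eq]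
    field_simp

/-- The frame of linearly independent vectors, with its defining triangularity. -/
theorem frameOf_spec (hn : 1 ≤ n) (h : LinearIndependent ℝ (fun j : Fin (n - 1) => D j)) :
    Orthonormal ℝ (fun i : Fin n => frameOf D i) ∧
    (∀ j m, j < m → m < n → inner ℝ (D j) (frameOf D m) = (0 : ℝ)) ∧
    (∀ j, j + 1 < n → 0 < (inner ℝ (D j) (frameOf D j) : ℝ)) := by
  have hgn : ∀ i, i + 1 < n → ‖gramSchmidtNormed ℝ D i‖ = 1 := fun i hi =>
    gramSchmidtNormed_unit_length' (by
      have := gramSchmidt_ne_zero_nat h (i := i) (by omega)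
      simpa [gramSchmidtNormed] using this)
  -- A unit normal to the given `n - 1` vectors, of either orientation, completes them to an
  -- orthonormal frame. The uniqueness lemma then makes the cross product equal to `± v`.
  obtain ⟨v, hv1, hv⟩ : ∃ v : EuclideanSpace ℝ (Fin n), ‖v‖ = 1 ∧
      ∀ i, i + 1 < n → inner ℝ (D i) v = (0 : ℝ) := by
    set S := Submodule.span ℝ (Set.range fun j : Fin (n - 1) => D j)
    have hS : Sᗮ ≠ ⊥ := by
      intro hb
      rw [Submodule.orthogonal_eq_bot_iff] at hb
      have h1 := finrank_span_eq_card h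
      change Module.finrank ℝ S = _ at h1
      rw [hb, finrank_top] at h1
      simp at h1
      omega
    obtain ⟨w, hw, hw0⟩ := Submodule.exists_mem_ne_zero_of_ne_bot hS
    refine ⟨(‖w‖⁻¹ : ℝ) • w, norm_smul_inv_norm hw0, fun i hi => ?_⟩
    rw [inner_smul_right, (Submodule.mem_orthogonal S w).1 hw (D i)
      (Submodule.subset_span ⟨⟨i, by omega⟩, rfl⟩), mul_zero]
  set f : ℕ → EuclideanSpace ℝ (Fin n) :=
    fun i => if i + 1 < n then gramSchmidtNormed ℝ D i else v with hfd
  have hgv : ∀ i, i + 1 < n → inner ℝ (gramSchmidtNormed ℝ D i) v = (0 : ℝ) := by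
    intro i hi
    have hm : gramSchmidtNormed ℝ D i ∈ Submodule.span ℝ (D '' Set.Iic i) := by
      rw [gramSchmidtNormed]
      exact Submodule.smul_mem _ _ (gramSchmidt_mem_span ℝ D le_rfl)
    have hle : Submodule.span ℝ (D '' Set.Iic i) ≤ LinearMap.ker (innerSL ℝ v).toLinearMap := by
      rw [Submodule.span_le]
      rintro _ ⟨j, hj, rfl⟩
      have hj' : j ≤ i := hj
      have := hv j (by omega)
      rw [real_inner_comm] at this
      simpa using this
    have := hle hm
    rw [real_inner_comm]
    simpa using this
  have hf : Orthonormal ℝ (fun i : Fin n => f i) := by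
    refine ⟨fun i => ?_, fun i j hij => ?_⟩
    · simp only [hfd]
      split_ifs with hi
      · exact hgn i hi
      · exact hv1
    · have hij' : (i : ℕ) ≠ j := fun h => hij (Fin.ext h)
      simp only [hfd]
      split_ifs with hi hj hj
      · simp [gramSchmidtNormed, inner_smul_left, inner_smul_right,
          gramSchmidt_orthogonal ℝ D hij']
      · exact hgv i hi
      · rw [real_inner_comm]; exact hgv j hj
      · have := i.2
        have := j.2
        omega
  have h0 : ∀ j m, j < m → m < n → inner ℝ (D j) (f m) = (0 : ℝ) := by
    intro j m hjm hm
    simp only [hfd]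
    split_ifs with h1
    · exact inner_gramSchmidt_eq_zero hjm
    · exact hv j (by omega)
  have hpos : ∀ j, j + 1 < n → 0 < (inner ℝ (D j) (f j) : ℝ) := by
    intro j hj
    simp only [hfd, if_pos hj]
    rw [inner_gramSchmidtNormed_self]
    exact norm_pos_iff.2 (gramSchmidt_ne_zero_nat h (by omega))
  obtain ⟨hA, ε, hε, hB⟩ := frameOf_eq_of_triangular hn hf h0 hpos
  have hfr : ∀ i, i < n → ∃ δ : ℝ, δ ^ 2 = 1 ∧ frameOf D i = δ • f i := by
    intro i hi
    by_cases h1 : i + 1 < n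
    · exact ⟨1, by norm_num, by rw [hA i h1, one_smul]⟩
    · obtain rfl : i = n - 1 := by omega
      exact ⟨ε, hε, hB⟩
  refine ⟨⟨fun i => ?_, fun i j hij => ?_⟩, fun j m hjm hm => ?_, fun j hj => ?_⟩
  · obtain ⟨δ, hδ, e⟩ := hfr i i.2
    have h1 : |δ| = 1 := by
      rw [← Real.sqrt_sq_eq_abs, hδ, Real.sqrt_one]
    simp only [e, norm_smul, Real.norm_eq_abs, h1, one_mul]
    exact hf.1 i
  · obtain ⟨δ, hδ, e⟩ := hfr i i.2
    obtain ⟨δ', hδ', e'⟩ := hfr j j.2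
    have := hf.2 hij
    simp only [e, e', inner_smul_left, inner_smul_right]
    rw [this]; simp
  · obtain ⟨δ, hδ, e⟩ := hfr m hm
    rw [e, inner_smul_right, h0 j m hjm hm, mul_zero]
  · rw [hA j hj]; exact hpos j hj

theorem frameOf_mem_span {i : ℕ} (hi : i + 1 < n) :
    frameOf D i ∈ Submodule.span ℝ (D '' Set.Iic i) := by
  rw [frameOf_of_lt D hi, gramSchmidtNormed]
  exact Submodule.smul_mem _ _ (gramSchmidt_mem_span ℝ D le_rfl)

end Frame

/-! ### The Frenet equations, and twistedness in terms of derivatives. -/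

section System

variable {n : ℕ}

theorem ContDiffOn.hasDerivAt_iteratedDeriv {F : Type*} [NormedAddCommGroup F] [NormedSpace ℝ F]
    {α : ℝ → F} {I : Set ℝ} (h : ContDiffOn ℝ n α I) (hI : IsOpen I) {j : ℕ} (hj : j < n) {t : ℝ}
    (ht : t ∈ I) : HasDerivAt (iteratedDeriv j α) (iteratedDeriv (j + 1) α t) t := by
  have h1 : DifferentiableOn ℝ (iteratedDerivWithin j α I) I :=
    h.differentiableOn_iteratedDerivWithin (by exact_mod_cast hj) hI.uniqueDiffOn
  have h2 := (h1 t ht).differentiableAt (hI.mem_nhds ht)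
  have h3 : iteratedDerivWithin j α I =ᶠ[nhds t] iteratedDeriv j α := by
    filter_upwards [hI.mem_nhds ht] with s hs using iteratedDerivWithin_of_isOpen hI hs
  rw [iteratedDeriv_succ]
  exact (h2.congr_of_eventuallyEq h3.symm).hasDerivAt

theorem differentiableAt_gramSchmidt {D : ℕ → ℝ → EuclideanSpace ℝ (Fin n)} {t : ℝ} {i : ℕ}
    (hD : ∀ j ≤ i, DifferentiableAt ℝ (D j) t)
    (h0 : ∀ j < i, gramSchmidt ℝ (fun j => D j t) j ≠ 0) :
    DifferentiableAt ℝ (fun s => gramSchmidt ℝ (fun j => D j s) i) t := by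
  induction i using Nat.strong_induction_on with
  | _ i ih =>
  have e : (fun s => gramSchmidt ℝ (fun j => D j s) i) = fun s => D i s - ∑ j ∈ Finset.Iio i,
      (inner ℝ (gramSchmidt ℝ (fun j => D j s) j) (D i s) /
        ‖gramSchmidt ℝ (fun j => D j s) j‖ ^ 2) • gramSchmidt ℝ (fun j => D j s) j := by
    funext s
    have := gramSchmidt_def'' ℝ (fun j => D j s) i
    exact eq_sub_of_add_eq this.symm
  rw [e]
  refine (hD i le_rfl).sub (DifferentiableAt.fun_sum fun j hj => ?_)
  have hj' : j < i := Finset.mem_Iio.1 hj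
  have hg := ih j hj' (fun l hl => hD l (by omega)) (fun l hl => h0 l (by omega))
  have hne : ‖gramSchmidt ℝ (fun j => D j t) j‖ ^ 2 ≠ 0 := by simpa using h0 j hj'
  exact ((hg.inner ℝ (hD i le_rfl)).div (hg.norm_sq ℝ) hne).smul hg

theorem differentiableAt_frameOf {D : ℕ → ℝ → EuclideanSpace ℝ (Fin n)} {t : ℝ}
    (hD : ∀ j, j + 1 < n → DifferentiableAt ℝ (D j) t)
    (h : LinearIndependent ℝ (fun j : Fin (n - 1) => D j t)) (i : ℕ) :
    DifferentiableAt ℝ (fun s => frameOf (fun j => D j s) i) t := by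
  have hg : ∀ i, i + 1 < n →
      DifferentiableAt ℝ (fun s => gramSchmidtNormed ℝ (fun j => D j s) i) t := by
    intro i hi
    have h0 : ∀ j, j + 1 < n → gramSchmidt ℝ (fun j => D j t) j ≠ 0 := fun j hj =>
      gramSchmidt_ne_zero_nat (D := fun j => D j t) h (by omega)
    have h1 := differentiableAt_gramSchmidt (i := i) (fun j hj => hD j (by omega))
      (fun j hj => h0 j (by omega))
    exact (h1.norm ℝ (h0 i hi)).inv (by simpa using h0 i hi) |>.smul h1
  by_cases hi : i + 1 < n
  · simp only [frameOf_of_lt _ hi]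
    exact hg i hi
  · simp only [frameOf_of_not_lt _ hi, crossVector]
    rw [differentiableAt_euclidean]
    intro c
    simp only [Matrix.det_apply]
    refine DifferentiableAt.fun_sum fun σ _ => ?_
    refine DifferentiableAt.const_smul ?_ _
    refine DifferentiableAt.fun_finsetProd fun a _ => ?_
    simp only [Matrix.of_apply]
    split_ifs with h1 h2
    · exact differentiableAt_euclidean.1 (hg _ h1) a
    · exact differentiableAt_const _
    · exact differentiableAt_const _

/-- An orthonormal moving frame of `ℝⁿ` along the curve `α` which satisfies the Frenet
equations: `w` is the speed, `K` the skew-symmetric tridiagonal matrix of the curvatures. -/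
structure FrenetSystem (α : ℝ → EuclideanSpace ℝ (Fin n)) (f : ℕ → ℝ → EuclideanSpace ℝ (Fin n))
    (w : ℝ → ℝ) (K : ℕ → ℕ → ℝ → ℝ) (I : Set ℝ) : Prop where
  orthonormal : ∀ t ∈ I, Orthonormal ℝ (fun i : Fin n => f i t)
  hasDerivAt : ∀ t ∈ I, HasDerivAt α (w t • f 0 t) t
  speed_pos : ∀ t ∈ I, 0 < w t
  frame : ∀ t ∈ I, ∀ i < n, HasDerivAt (f i) (w t • ∑ j : Fin n, K i j t • f j t) t
  skew : ∀ t ∈ I, ∀ i < n, ∀ j < n, K i j t = -K j i t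
  tridiagonal : ∀ t ∈ I, ∀ i j, i + 1 < j → j < n → K i j t = 0
  pos : ∀ t ∈ I, ∀ i, i + 2 < n → 0 < K i (i + 1) t

/-- The matrix of the Frenet equations of a curve. -/
noncomputable def frenetMatrix (α : ℝ → EuclideanSpace ℝ (Fin n)) (i j : ℕ) (t : ℝ) : ℝ :=
  inner ℝ (deriv (frenetVector α i) t) (frenetVector α j t) / ‖deriv α t‖

theorem frenetCurvature_eq_frenetMatrix (α : ℝ → EuclideanSpace ℝ (Fin n)) (i : ℕ) (t : ℝ) :
    frenetCurvature α i t = frenetMatrix α i (i + 1) t := rfl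

variable {α : ℝ → EuclideanSpace ℝ (Fin n)} {I : Set ℝ}

namespace IsFrenetCurve

theorem frame_spec (h : IsFrenetCurve α I) (hn : 2 ≤ n) {t : ℝ} (ht : t ∈ I) :
    Orthonormal ℝ (fun i : Fin n => frenetVector α i t) ∧
    (∀ j m, j < m → m < n →
      inner ℝ (iteratedDeriv (j + 1) α t) (frenetVector α m t) = (0 : ℝ)) ∧
    (∀ j, j + 1 < n →
      0 < (inner ℝ (iteratedDeriv (j + 1) α t) (frenetVector α j t) : ℝ)) :=
  frameOf_spec (D := fun j => iteratedDeriv (j + 1) α t) (by omega) (h.2 t ht)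

theorem differentiableAt_frenetVector (h : IsFrenetCurve α I) (hI : IsOpen I)
    {t : ℝ} (ht : t ∈ I) (i : ℕ) : DifferentiableAt ℝ (frenetVector α i) t :=
  differentiableAt_frameOf (D := fun j s => iteratedDeriv (j + 1) α s)
    (fun _ hj => (h.1.hasDerivAt_iteratedDeriv hI hj ht).differentiableAt) (h.2 t ht) i

theorem inner_deriv_skew (h : IsFrenetCurve α I) (hn : 2 ≤ n) (hI : IsOpen I) {t : ℝ}
    (ht : t ∈ I) {i j : ℕ} (hi : i < n) (hj : j < n) :
    inner ℝ (deriv (frenetVector α i) t) (frenetVector α j t) =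
      -(inner ℝ (frenetVector α i t) (deriv (frenetVector α j) t) : ℝ) := by
  have h1 := (h.differentiableAt_frenetVector hI ht i).hasDerivAt.inner ℝ
    (h.differentiableAt_frenetVector hI ht j).hasDerivAt
  have h2 : (fun s => (inner ℝ (frenetVector α i s) (frenetVector α j s) : ℝ)) =ᶠ[nhds t]
      fun _ => if i = j then 1 else 0 := by
    filter_upwards [hI.mem_nhds ht] with s hs
    exact Orthonormal.inner_nat (f := fun i => frenetVector α i s) (h.frame_spec hn hs).1 hi hj
  have h3 := (h1.congr_of_eventuallyEq h2.symm).unique (hasDerivAt_const t _)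
  linarith

/-- Differentiating the orthogonality of `α^{(j+1)}` and `e_m`. -/
theorem inner_iteratedDeriv_deriv (h : IsFrenetCurve α I) (hn : 2 ≤ n) (hI : IsOpen I) {t : ℝ}
    (ht : t ∈ I) {j m : ℕ} (hjm : j < m) (hm : m < n) :
    inner ℝ (iteratedDeriv (j + 1) α t) (deriv (frenetVector α m) t) =
      -(inner ℝ (iteratedDeriv (j + 2) α t) (frenetVector α m t) : ℝ) := by
  have h1 := (h.1.hasDerivAt_iteratedDeriv hI (j := j + 1) (by omega) ht).inner ℝ
    (h.differentiableAt_frenetVector hI ht m).hasDerivAt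
  have h2 : (fun s => (inner ℝ (iteratedDeriv (j + 1) α s) (frenetVector α m s) : ℝ)) =ᶠ[nhds t]
      fun _ => 0 := by
    filter_upwards [hI.mem_nhds ht] with s hs
    exact (h.frame_spec hn hs).2.1 j m hjm hm
  have h3 := (h1.congr_of_eventuallyEq h2.symm).unique (hasDerivAt_const t _)
  linarith

/-- `e_j` lies in the span of `α', …, α^{(j+1)}` (frame numbered from 0), and the next derivatives
of these are still orthogonal to `e_m`. This is the source of tridiagonality. -/
theorem inner_frenetVector_deriv_eq_zero (h : IsFrenetCurve α I) (hn : 2 ≤ n) (hI : IsOpen I)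
    {t : ℝ} (ht : t ∈ I) {j m : ℕ} (hjm : j + 1 < m) (hm : m < n) :
    inner ℝ (frenetVector α j t) (deriv (frenetVector α m) t) = (0 : ℝ) := by
  have hmem := frameOf_mem_span (D := fun j => iteratedDeriv (j + 1) α t) (i := j) (n := n)
    (by omega)
  have hle : Submodule.span ℝ ((fun j => iteratedDeriv (j + 1) α t) '' Set.Iic j) ≤
      LinearMap.ker (innerSL ℝ (deriv (frenetVector α m) t)).toLinearMap := by
    rw [Submodule.span_le]
    rintro _ ⟨i, hi, rfl⟩
    have hi' : i ≤ j := hi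
    have h1 := h.inner_iteratedDeriv_deriv hn hI ht (j := i) (m := m) (by omega) hm
    rw [(h.frame_spec hn ht).2.1 (i + 1) m (by omega) hm, neg_zero, real_inner_comm] at h1
    simpa using h1
  have := hle hmem
  rw [real_inner_comm]
  simpa [frenetVector_eq_frameOf] using this

theorem deriv_eq (h : IsFrenetCurve α I) (hn : 2 ≤ n) {t : ℝ} (ht : t ∈ I) :
    0 < ‖deriv α t‖ ∧ deriv α t = ‖deriv α t‖ • frenetVector α 0 t := by
  have hs := h.frame_spec hn ht
  have hp := hs.2.2 0 (by omega)
  simp only [zero_add, iteratedDeriv_one] at hp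
  have hsum : deriv α t =
      (inner ℝ (deriv α t) (frenetVector α 0 t) : ℝ) • frenetVector α 0 t := by
    refine Orthonormal.eq_of_inner (f := fun i => frenetVector α i t) hs.1 fun i hi => ?_
    rw [inner_smul_right, hs.1.inner_nat (f := fun i => frenetVector α i t) hi (by omega)]
    rcases Nat.eq_zero_or_pos i with rfl | h0
    · simp [real_inner_comm]
    · have := hs.2.1 0 i h0 hi
      simp only [zero_add, iteratedDeriv_one] at this
      rw [real_inner_comm, this]
      simp [h0.ne']
  have hnorm : ‖deriv α t‖ = inner ℝ (deriv α t) (frenetVector α 0 t) := by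
    have h1 : ‖frenetVector α 0 t‖ = 1 := hs.1.1 ⟨0, by omega⟩
    have := congrArg norm hsum
    rwa [norm_smul, h1, mul_one, Real.norm_of_nonneg hp.le] at this
  rw [hnorm]
  exact ⟨hp, hsum⟩

/-- Differentiate `⟨α^{(i+1)}, e_{i+1}⟩ = 0` and expand `α^{(i+1)}` in the frame: components beyond
`e_i` vanish by triangularity, and those before it are orthogonal to `e_{i+1}'`. Curvatures thus
become ratios of diagonal entries, which controls their signs and zeros. -/
theorem frenetCurvature_mul (h : IsFrenetCurve α I) (hn : 2 ≤ n) (hI : IsOpen I) {t : ℝ}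
    (ht : t ∈ I) {i : ℕ} (hi : i + 1 < n) :
    frenetCurvature α i t *
        (‖deriv α t‖ * inner ℝ (iteratedDeriv (i + 1) α t) (frenetVector α i t)) =
      inner ℝ (iteratedDeriv (i + 2) α t) (frenetVector α (i + 1) t) := by
  have hs := h.frame_spec hn ht
  have hw := (h.deriv_eq hn ht).1
  have h1 := h.inner_iteratedDeriv_deriv hn hI ht (j := i) (m := i + 1) (by omega) hi
  have he := Orthonormal.eq_sum (f := fun i => frenetVector α i t) hs.1 (iteratedDeriv (i + 1) α t)
  have h2 : (inner ℝ (iteratedDeriv (i + 1) α t) (deriv (frenetVector α (i + 1)) t) : ℝ) =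
      inner ℝ (iteratedDeriv (i + 1) α t) (frenetVector α i t) *
        inner ℝ (frenetVector α i t) (deriv (frenetVector α (i + 1)) t) := by
    conv_lhs => rw [he]
    rw [sum_inner, Finset.sum_eq_single (⟨i, by omega⟩ : Fin n)]
    · rw [inner_smul_left, real_inner_comm]
      rfl
    · intro j _ hj
      have hj' : (j : ℕ) ≠ i := fun e => hj (Fin.ext e)
      rw [inner_smul_left]
      rcases lt_or_gt_of_ne hj' with hlt | hgt
      · rw [h.inner_frenetVector_deriv_eq_zero hn hI ht (by omega) hi, mul_zero]
      · have := hs.2.1 i j hgt j.2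
        rw [real_inner_comm] at this
        simp [this]
    · simp
  have h3 := h.inner_deriv_skew hn hI ht (i := i) (j := i + 1) (by omega) hi
  rw [frenetCurvature, h3]
  rw [h2] at h1
  field_simp
  linarith

theorem frenetSystem (h : IsFrenetCurve α I) (hn : 2 ≤ n) (hI : IsOpen I) :
    FrenetSystem α (frenetVector α) (fun t => ‖deriv α t‖) (frenetMatrix α) I where
  orthonormal t ht := (h.frame_spec hn ht).1
  hasDerivAt t ht := by
    have h1 := h.1.hasDerivAt_iteratedDeriv hI (j := 0) (by omega) ht
    rw [zero_add, iteratedDeriv_one, iteratedDeriv_zero] at h1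
    rwa [← (h.deriv_eq hn ht).2]
  speed_pos t ht := (h.deriv_eq hn ht).1
  frame t ht i hi := by
    have hw := (h.deriv_eq hn ht).1
    refine (h.differentiableAt_frenetVector hI ht i).hasDerivAt.congr_deriv ?_
    refine (Orthonormal.eq_sum (f := fun i => frenetVector α i t) (h.frame_spec hn ht).1
      (deriv (frenetVector α i) t)).trans ?_
    rw [Finset.smul_sum]
    refine Finset.sum_congr rfl fun j _ => ?_
    rw [smul_smul, frenetMatrix, real_inner_comm]
    congr 1
    field_simp
  skew t ht i hi j hj := by
    rw [frenetMatrix, frenetMatrix, h.inner_deriv_skew hn hI ht hi hj, real_inner_comm]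
    ring
  tridiagonal t ht i j hij hj := by
    rw [frenetMatrix, h.inner_deriv_skew hn hI ht (by omega) hj,
      h.inner_frenetVector_deriv_eq_zero hn hI ht hij hj]
    simp
  -- The range `i + 2 < n` stops before the last curvature, whose sign is free: the diagonal entry
  -- is known to be positive only for the Gram–Schmidt vectors.
  pos t ht i hi := by
    have hs := h.frame_spec hn ht
    have hw := (h.deriv_eq hn ht).1
    have h1 := h.frenetCurvature_mul hn hI ht (i := i) (by omega)
    have h2 := hs.2.2 (i + 1) (by omega)
    have h3 := hs.2.2 i (by omega)
    rw [← frenetCurvature_eq_frenetMatrix]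
    rw [show i + 1 + 1 = i + 2 from rfl, ← h1] at h2
    exact pos_of_mul_pos_left h2 (by positivity)

/-- The last curvature of a Frenet curve does not vanish at `t` iff the first `n` derivatives
are linearly independent at `t`. -/
theorem frenetCurvature_last_ne_zero_iff (h : IsFrenetCurve α I) (hn : 2 ≤ n) (hI : IsOpen I)
    {t : ℝ} (ht : t ∈ I) : frenetCurvature α (n - 2) t ≠ 0 ↔
      LinearIndependent ℝ (fun j : Fin n => iteratedDeriv ((j : ℕ) + 1) α t) := by
  have hs := h.frame_spec hn ht
  have hw := (h.deriv_eq hn ht).1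
  have h1 := h.frenetCurvature_mul hn hI ht (i := n - 2) (by omega)
  have h3 := hs.2.2 (n - 2) (by omega)
  rw [show n - 2 + 1 = n - 1 by omega, show n - 2 + 2 = n - 1 + 1 by omega] at h1
  rw [show n - 2 + 1 = n - 1 by omega] at h3
  have h4 : frenetCurvature α (n - 2) t ≠ 0 ↔
      (inner ℝ (iteratedDeriv (n - 1 + 1) α t) (frenetVector α (n - 1) t) : ℝ) ≠ 0 := by
    rw [← h1, mul_ne_zero_iff]
    exact ⟨fun h => ⟨h, by positivity⟩, fun h => h.1⟩
  rw [h4]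
  constructor
  · intro h5
    refine linearIndependent_of_triangular (D := fun j => iteratedDeriv (j + 1) α t)
      (f := fun i => frenetVector α i t) n (fun i j hij hj => hs.2.1 i j hij hj) fun j hj => ?_
    by_cases hj' : j + 1 < n
    · exact (hs.2.2 j hj').ne'
    · obtain rfl : j = n - 1 := by omega
      exact h5
  · intro h5 h6
    have hspan := h5.span_eq_top_of_card_eq_finrank' (by simp)
    have hle : Submodule.span ℝ (Set.range fun j : Fin n => iteratedDeriv ((j : ℕ) + 1) α t) ≤
        LinearMap.ker (innerSL ℝ (frenetVector α (n - 1) t)).toLinearMap := by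
      rw [Submodule.span_le]
      rintro _ ⟨i, rfl⟩
      have : (inner ℝ (iteratedDeriv ((i : ℕ) + 1) α t) (frenetVector α (n - 1) t) : ℝ) = 0 := by
        by_cases hi : (i : ℕ) < n - 1
        · exact hs.2.1 i (n - 1) hi (by omega)
        · rw [show (i : ℕ) = n - 1 by have := i.2; omega]
          exact h6
      rw [real_inner_comm] at this
      simpa using this
    rw [hspan] at hle
    have := hle (Submodule.mem_top (x := frenetVector α (n - 1) t))
    have h7 : ‖frenetVector α (n - 1) t‖ = 1 := hs.1.1 ⟨n - 1, by omega⟩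
    simp at this
    rw [this] at h7
    simp at h7

end IsFrenetCurve

theorem isTwistedCurve_iff (hn : 2 ≤ n) (hI : IsOpen I) : IsTwistedCurve α I ↔
    ContDiffOn ℝ n α I ∧
      ∀ t ∈ I, LinearIndependent ℝ (fun j : Fin n => iteratedDeriv ((j : ℕ) + 1) α t) := by
  constructor
  · rintro ⟨h, h'⟩
    exact ⟨h.1, fun t ht => (h.frenetCurvature_last_ne_zero_iff hn hI ht).1 (h' t ht)⟩
  · rintro ⟨h, h'⟩
    have hF : IsFrenetCurve α I := ⟨h, fun t ht =>
      (h' t ht).comp (Fin.castLE (Nat.sub_le n 1)) (Fin.castLE_injective _)⟩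
    exact ⟨hF, fun t ht => (hF.frenetCurvature_last_ne_zero_iff hn hI ht).2 (h' t ht)⟩

end System

/-! ### Recovering the curvatures from a Frenet system; invariance under congruence. -/

section Converse

variable {n : ℕ} {α : ℝ → EuclideanSpace ℝ (Fin n)} {I : Set ℝ}
  {f : ℕ → ℝ → EuclideanSpace ℝ (Fin n)} {w : ℝ → ℝ} {K : ℕ → ℕ → ℝ → ℝ}

namespace FrenetSystem

theorem deriv_eq (S : FrenetSystem α f w K I) {t : ℝ} (ht : t ∈ I) : deriv α t = w t • f 0 t :=
  (S.hasDerivAt t ht).deriv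

/-- Differentiating the orthogonality of `α^{(j+1)}` and `f m` leaves only the term with `K m j`.
Tridiagonality kills it for `m > j + 1`; for `m = j + 1` it multiplies the diagonal entry by `w * K
j (j+1)`, which is positive in the range needed. So `f` meets the criterion of
`frameOf_eq_of_triangular`. -/
theorem triangular (S : FrenetSystem α f w K I) (hI : IsOpen I)
    (hα : ContDiffOn ℝ n α I) (j : ℕ) (hj : j < n) :
    ∀ t ∈ I, (∀ m, j < m → m < n → inner ℝ (iteratedDeriv (j + 1) α t) (f m t) = (0 : ℝ)) ∧
      (j + 1 < n → 0 < (inner ℝ (iteratedDeriv (j + 1) α t) (f j t) : ℝ)) := by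
  induction j with
  | zero =>
    intro t ht
    simp only [zero_add, iteratedDeriv_one, S.deriv_eq ht, inner_smul_left, conj_trivial]
    refine ⟨fun m hm hmn => ?_, fun _ => ?_⟩
    · rw [(S.orthonormal t ht).inner_nat (f := fun i => f i t) (by omega) hmn]
      simp [hm.ne]
    · rw [(S.orthonormal t ht).inner_nat (f := fun i => f i t) (by omega) (by omega)]
      simpa using S.speed_pos t ht
  | succ j ih =>
    intro t ht
    have key : ∀ m, j < m → m < n → inner ℝ (iteratedDeriv (j + 2) α t) (f m t) =
        -(w t * (K m j t * inner ℝ (iteratedDeriv (j + 1) α t) (f j t))) := by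
      intro m hm hmn
      have h1 := (hα.hasDerivAt_iteratedDeriv hI (j := j + 1) hj ht).inner ℝ (S.frame t ht m hmn)
      have h2 : (fun s => (inner ℝ (iteratedDeriv (j + 1) α s) (f m s) : ℝ)) =ᶠ[nhds t]
          fun _ => 0 := by
        filter_upwards [hI.mem_nhds ht] with s hs
        exact (ih (by omega) s hs).1 m hm hmn
      have h3 := (h1.congr_of_eventuallyEq h2.symm).unique (hasDerivAt_const t _)
      have h4 : (inner ℝ (iteratedDeriv (j + 1) α t) (∑ l : Fin n, K m l t • f l t) : ℝ) =
          K m j t * inner ℝ (iteratedDeriv (j + 1) α t) (f j t) := by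
        rw [inner_sum, Finset.sum_eq_single (⟨j, by omega⟩ : Fin n)]
        · rw [inner_smul_right]
        · intro l _ hl
          have hl' : (l : ℕ) ≠ j := fun e => hl (Fin.ext e)
          rw [inner_smul_right]
          rcases lt_or_gt_of_ne hl' with hlt | hgt
          · rw [S.skew t ht m hmn l l.2, S.tridiagonal t ht l m (by omega) hmn]
            simp
          · rw [(ih (by omega) t ht).1 l hgt l.2, mul_zero]
        · simp
      rw [inner_smul_right, h4] at h3
      rw [show j + 1 + 1 = j + 2 from rfl] at h3
      linarith
    refine ⟨fun m hm hmn => ?_, fun hj' => ?_⟩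
    · rw [key m (by omega) hmn, S.skew t ht m hmn j (by omega), S.tridiagonal t ht j m hm hmn]
      simp
    · rw [show j + 1 + 1 = j + 2 from rfl, key (j + 1) (by omega) hj,
        S.skew t ht (j + 1) hj j (by omega)]
      have h1 := S.pos t ht j (by omega)
      have h2 := (ih (by omega) t ht).2 hj
      have h3 := S.speed_pos t ht
      rw [neg_mul, mul_neg, neg_neg]
      positivity

theorem isFrenetCurve (S : FrenetSystem α f w K I) (hn : 2 ≤ n) (hI : IsOpen I)
    (hα : ContDiffOn ℝ n α I) : IsFrenetCurve α I :=
  ⟨hα, fun t ht => linearIndependent_of_triangular (D := fun j => iteratedDeriv (j + 1) α t)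
    (f := fun i => f i t) (n - 1)
    (fun i j hij hj => (S.triangular hI hα i (by omega) t ht).1 j hij (by omega))
    (fun j hj => ((S.triangular hI hα j (by omega) t ht).2 (by omega)).ne')⟩

theorem frenetVector_eq (S : FrenetSystem α f w K I) (hn : 2 ≤ n) (hI : IsOpen I)
    (hα : ContDiffOn ℝ n α I) {t : ℝ} (ht : t ∈ I) :
    (∀ i, i + 1 < n → frenetVector α i t = f i t) ∧
      ∃ ε : ℝ, ε ^ 2 = 1 ∧ frenetVector α (n - 1) t = ε • f (n - 1) t :=
  frameOf_eq_of_triangular (D := fun j => iteratedDeriv (j + 1) α t) (f := fun i => f i t)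
    (by omega) (S.orthonormal t ht)
    (fun i j hij hj => (S.triangular hI hα i (by omega) t ht).1 j hij hj)
    (fun j hj => (S.triangular hI hα j (by omega) t ht).2 hj)

/-- A frame satisfying the Frenet equations gives the curvatures, the last one up to a sign. -/
theorem frenetCurvature_eq (S : FrenetSystem α f w K I) (hn : 2 ≤ n) (hI : IsOpen I)
    (hIc : IsPreconnected I) (hα : ContDiffOn ℝ n α I) {i : ℕ} (hi : i + 1 < n) :
    ∃ ε : ℝ, ε ^ 2 = 1 ∧ ∀ t ∈ I, frenetCurvature α i t = ε * K i (i + 1) t := by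
  have hF := S.isFrenetCurve hn hI hα
  have hcurv : ∀ t ∈ I, frenetCurvature α i t =
      inner ℝ (frenetVector α (i + 1) t) (f (i + 1) t) * K i (i + 1) t := by
    intro t ht
    have hw := S.speed_pos t ht
    have hon := S.orthonormal t ht
    have hd : deriv (frenetVector α i) t = w t • ∑ j : Fin n, K i j t • f j t := by
      refine ((S.frame t ht i (by omega)).congr_of_eventuallyEq ?_).deriv
      filter_upwards [hI.mem_nhds ht] with s hs
      exact (S.frenetVector_eq hn hI hα hs).1 i hi
    have hnorm : ‖deriv α t‖ = w t := by
      rw [S.deriv_eq ht, norm_smul, Real.norm_of_nonneg hw.le]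
      have : ‖f 0 t‖ = 1 := hon.1 ⟨0, by omega⟩
      rw [this, mul_one]
    obtain ⟨δ, hδ⟩ : ∃ δ : ℝ, frenetVector α (i + 1) t = δ • f (i + 1) t := by
      by_cases h : i + 1 + 1 < n
      · exact ⟨1, by rw [(S.frenetVector_eq hn hI hα ht).1 _ h, one_smul]⟩
      · obtain ⟨ε, -, h2⟩ := (S.frenetVector_eq hn hI hα ht).2
        refine ⟨ε, ?_⟩
        rwa [show n - 1 = i + 1 by omega] at h2
    have hself := hon.inner_nat (f := fun i => f i t) hi hi
    rw [frenetCurvature, hd, hnorm, hδ, inner_smul_left, inner_smul_left, inner_smul_right, hself,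
      sum_inner, Finset.sum_eq_single (⟨i + 1, hi⟩ : Fin n)]
    · rw [inner_smul_left, hself]
      simp only [conj_trivial, if_true]
      field_simp
    · intro j _ hj
      have hj' : (j : ℕ) ≠ i + 1 := fun e => hj (Fin.ext e)
      rw [inner_smul_left, hon.inner_nat (f := fun i => f i t) j.2 hi]
      simp [hj']
    · simp
  -- The sign relating the two frames could a priori depend on `t`; it is a continuous function with
  -- square `1` on a connected set, hence constant.
  have hcont : ContinuousOn (fun t => (inner ℝ (frenetVector α (i + 1) t) (f (i + 1) t) : ℝ)) I :=
    fun t ht => ((hF.differentiableAt_frenetVector hI ht (i + 1)).inner ℝ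
      (S.frame t ht (i + 1) hi).differentiableAt).continuousAt.continuousWithinAt
  have hsq : Set.EqOn ((fun t => (inner ℝ (frenetVector α (i + 1) t) (f (i + 1) t) : ℝ)) ^ 2)
      1 I := by
    intro t ht
    have hself := (S.orthonormal t ht).inner_nat (f := fun i => f i t) hi hi
    rw [if_pos rfl] at hself
    simp only [Pi.pow_apply, Pi.one_apply]
    by_cases h : i + 1 + 1 < n
    · rw [(S.frenetVector_eq hn hI hα ht).1 _ h, hself, one_pow]
    · obtain ⟨ε, h1, h2⟩ := (S.frenetVector_eq hn hI hα ht).2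
      rw [show n - 1 = i + 1 by omega] at h2
      rw [h2, inner_smul_left, hself]
      simpa using h1
  rcases hIc.eq_one_or_eq_neg_one_of_sq_eq hcont hsq with h | h
  · refine ⟨1, by norm_num, fun t ht => ?_⟩
    rw [hcurv t ht]
    have := h ht
    simp only [Pi.one_apply] at this
    rw [this]
  · refine ⟨-1, by norm_num, fun t ht => ?_⟩
    rw [hcurv t ht]
    have := h ht
    simp only [Pi.neg_apply, Pi.one_apply] at this
    rw [this]

end FrenetSystem

/-- Being twisted with constant curvatures is invariant under isometries and changes of
parameter. -/
theorem IsCongruentReparam.isTwistedCurve {α β : ℝ → EuclideanSpace ℝ (Fin n)}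
    (h : IsCongruentReparam α β I) (hn : 2 ≤ n) (hI : IsOpen I) (hIc : IsPreconnected I)
    (hβ : IsTwistedCurve β Set.univ) (hβc : HasConstantCurvatures β Set.univ) :
    IsTwistedCurve α I ∧ HasConstantCurvatures α I := by
  obtain ⟨A, φ, hφ, hφpos, hα⟩ := h
  have hS := hβ.1.frenetSystem hn isOpen_univ
  set L := A.linearIsometryEquiv with hL
  have hφd : ∀ t ∈ I, HasDerivAt φ (deriv φ t) t := fun t ht =>
    ((hφ.differentiableOn (by exact_mod_cast (by omega : n ≠ 0)) t ht).differentiableAt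
      (hI.mem_nhds ht)).hasDerivAt
  have hαC : ContDiffOn ℝ n α I := by
    have hA : ContDiff ℝ n A := A.toAffineIsometry.toContinuousAffineMap.contDiff
    have h1 : ContDiff ℝ n β := contDiffOn_univ.1 hβ.1.1
    exact (hA.comp_contDiffOn (h1.comp_contDiffOn hφ)).congr hα
  -- The isometry may reverse orientation. A `FrenetSystem` does not ask for a positive frame, so
  -- the image frame is admissible as it is.
  have S : FrenetSystem α (fun i t => L (frenetVector β i (φ t)))
      (fun t => deriv φ t * ‖deriv β (φ t)‖) (fun i j t => frenetMatrix β i j (φ t)) I :=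
    { orthonormal := fun t ht => (hS.orthonormal (φ t) trivial).comp_linearIsometryEquiv L
      hasDerivAt := fun t ht => by
        have h1 := (hS.hasDerivAt (φ t) trivial).scomp t (hφd t ht)
        have h2 := L.toContinuousLinearEquiv.toContinuousLinearMap.hasFDerivAt.comp_hasDerivAt t h1
        have h3 : α =ᶠ[nhds t] fun s => L (β (φ s)) + A 0 := by
          filter_upwards [hI.mem_nhds ht] with s hs
          rw [hα s hs]
          have := A.map_vadd 0 (β (φ s))
          simpa using this
        refine ((h2.add_const (A 0)).congr_of_eventuallyEq h3).congr_deriv ?_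
        simp [mul_smul]
      speed_pos := fun t ht => mul_pos (hφpos t ht) (hS.speed_pos (φ t) trivial)
      frame := fun t ht i hi => by
        have h1 := (hS.frame (φ t) trivial i hi).scomp t (hφd t ht)
        have h2 := L.toContinuousLinearEquiv.toContinuousLinearMap.hasFDerivAt.comp_hasDerivAt t h1
        refine h2.congr_deriv ?_
        simp [mul_smul]
      skew := fun t ht => hS.skew (φ t) trivial
      tridiagonal := fun t ht => hS.tridiagonal (φ t) trivial
      pos := fun t ht => hS.pos (φ t) trivial }
  refine ⟨⟨S.isFrenetCurve hn hI hαC, fun t ht => ?_⟩, fun i hi => ?_⟩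
  · obtain ⟨ε, h1, h2⟩ := S.frenetCurvature_eq hn hI hIc hαC (i := n - 2) (by omega)
    rw [h2 t ht, ← frenetCurvature_eq_frenetMatrix]
    refine mul_ne_zero (fun h0 => ?_) (hβ.2 (φ t) trivial)
    rw [h0] at h1
    norm_num at h1
  · obtain ⟨ε, -, h2⟩ := S.frenetCurvature_eq hn hI hIc hαC hi
    obtain ⟨c, hc⟩ := hβc i hi
    refine ⟨ε * c, fun t ht => ?_⟩
    rw [h2 t ht, ← frenetCurvature_eq_frenetMatrix, hc (φ t) trivial]

end Converse

/-! ### Curves whose derivatives evolve by a skew-symmetric map. -/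

section Homogeneous

variable {n : ℕ} {β : ℝ → EuclideanSpace ℝ (Fin n)}
  {R : EuclideanSpace ℝ (Fin n) →ₗ[ℝ] EuclideanSpace ℝ (Fin n)}

/-- Skewness makes inner products of solutions of `x' = R x` constant, so the Gram–Schmidt
coefficients have zero derivative and `R` passes through the recursion. -/
theorem hasDerivAt_gramSchmidt_of_skew (hR : ∀ x y, inner ℝ (R x) y = -(inner ℝ x (R y) : ℝ))
    {D : ℕ → ℝ → EuclideanSpace ℝ (Fin n)} (hD : ∀ j t, HasDerivAt (D j) (R (D j t)) t) {m : ℕ}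
    (h0 : ∀ t, ∀ j < m, gramSchmidt ℝ (fun j => D j t) j ≠ 0) (i : ℕ) (hi : i < m) (t : ℝ) :
    HasDerivAt (fun s => gramSchmidt ℝ (fun j => D j s) i)
      (R (gramSchmidt ℝ (fun j => D j t) i)) t := by
  induction i using Nat.strong_induction_on with
  | _ i ih =>
  have e : ∀ s, gramSchmidt ℝ (fun j => D j s) i = D i s - ∑ j ∈ Finset.Iio i,
      (inner ℝ (gramSchmidt ℝ (fun j => D j s) j) (D i s) /
        ‖gramSchmidt ℝ (fun j => D j s) j‖ ^ 2) • gramSchmidt ℝ (fun j => D j s) j := by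
    intro s
    have := gramSchmidt_def'' ℝ (fun j => D j s) i
    exact eq_sub_of_add_eq this.symm
  rw [funext e, e t, map_sub, map_sum]
  refine (hD i t).sub (HasDerivAt.fun_sum fun j hj => ?_)
  have hj' : j < i := Finset.mem_Iio.1 hj
  have hg := ih j hj' (by omega)
  have hne : ‖gramSchmidt ℝ (fun j => D j t) j‖ ^ 2 ≠ 0 := by simpa using h0 t j (by omega)
  refine (((hg.inner ℝ (hD i t)).div hg.norm_sq hne).smul hg).congr_deriv ?_
  have h1 := hR (gramSchmidt ℝ (fun j => D j t) j) (gramSchmidt ℝ (fun j => D j t) j)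
  rw [real_inner_comm] at h1
  have h2 : (inner ℝ (gramSchmidt ℝ (fun j => D j t) j)
    (R (gramSchmidt ℝ (fun j => D j t) j)) : ℝ) = 0 := by linarith
  rw [hR, h2]
  simp

theorem IsFrenetCurve.deriv_frenetVector_of_skew (hn : 2 ≤ n)
    (hR : ∀ x y, inner ℝ (R x) y = -(inner ℝ x (R y) : ℝ)) (hβ : IsFrenetCurve β Set.univ)
    (hD : ∀ j t, HasDerivAt (iteratedDeriv (j + 1) β) (R (iteratedDeriv (j + 1) β t)) t)
    {i : ℕ} (hi : i < n) (t : ℝ) :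
    HasDerivAt (frenetVector β i) (R (frenetVector β i t)) t := by
  have hRself : ∀ x, (inner ℝ x (R x) : ℝ) = 0 := by
    intro x
    have h1 := hR x x
    rw [real_inner_comm] at h1
    linarith
  have h0 : ∀ t, ∀ j < n - 1, gramSchmidt ℝ (fun j => iteratedDeriv (j + 1) β t) j ≠ 0 :=
    fun t j hj => gramSchmidt_ne_zero_nat
      (D := fun j => iteratedDeriv (j + 1) β t) (hβ.2 t trivial) hj
  have hlt : ∀ i, i + 1 < n → ∀ t, HasDerivAt (frenetVector β i) (R (frenetVector β i t)) t := by
    intro i hi t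
    obtain ⟨g, hgd⟩ : ∃ g : ℝ → EuclideanSpace ℝ (Fin n),
        ∀ s, g s = gramSchmidt ℝ (fun j => iteratedDeriv (j + 1) β s) i := ⟨_, fun _ => rfl⟩
    have hg : HasDerivAt g (R (g t)) t := by
      rw [funext hgd]
      exact hasDerivAt_gramSchmidt_of_skew hR (D := fun j s => iteratedDeriv (j + 1) β s) hD h0 i
        (by omega) t
    -- Through `‖g‖ ^ 2` the normalizing factor has a derivative proportional to `⟨g, R g⟩`, which
    -- is zero.
    have e : frenetVector β i = fun s => (Real.sqrt (‖g s‖ ^ 2))⁻¹ • g s := by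
      funext s
      rw [Real.sqrt_sq (norm_nonneg _), frenetVector_eq_frameOf, frameOf_of_lt _ hi, hgd]
      rfl
    have hne : ‖g t‖ ^ 2 ≠ 0 := by
      rw [hgd]
      simpa using h0 t i (by omega)
    have hs : Real.sqrt (‖g t‖ ^ 2) ≠ 0 := by positivity
    have hq := (hg.norm_sq.sqrt hne).fun_inv hs
    rw [e]
    refine (hq.fun_smul hg).congr_deriv ?_
    rw [hRself]
    simp
  by_cases h : i + 1 < n
  · exact hlt i h t
  · obtain rfl : i = n - 1 := by omega
    have hd := (hβ.differentiableAt_frenetVector isOpen_univ (t := t) trivial (n - 1)).hasDerivAt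
    -- The last vector is not a Gram–Schmidt output; its derivative is found from its pairings with
    -- the frame, using skewness of the frame matrix and of `R`.
    refine hd.congr_deriv ?_
    refine Orthonormal.eq_of_inner (f := fun i => frenetVector β i t)
      (hβ.frame_spec hn (t := t) trivial).1 fun j hj => ?_
    have h1 := hβ.inner_deriv_skew hn isOpen_univ (t := t) trivial hi hj
    rw [real_inner_comm, h1]
    by_cases hj' : j + 1 < n
    · rw [(hlt j hj' t).deriv, real_inner_comm, hR, neg_neg, real_inner_comm]
    · obtain rfl : j = n - 1 := by omega
      rw [hRself]
      rw [real_inner_comm] at h1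
      linarith

/-- A Frenet curve whose velocity is an orbit of a one-parameter group of rotations has constant
curvatures. -/
theorem IsFrenetCurve.hasConstantCurvatures_of_skew (hn : 2 ≤ n)
    (hR : ∀ x y, inner ℝ (R x) y = -(inner ℝ x (R y) : ℝ)) (hβ : IsFrenetCurve β Set.univ)
    (hD : ∀ j t, HasDerivAt (iteratedDeriv (j + 1) β) (R (iteratedDeriv (j + 1) β t)) t) :
    HasConstantCurvatures β Set.univ := by
  intro i hi
  have hd : ∀ t, HasDerivAt (frenetVector β i) (R (frenetVector β i t)) t :=
    fun t => hβ.deriv_frenetVector_of_skew hn hR hD (by omega) t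
  have hd' : ∀ t, HasDerivAt (frenetVector β (i + 1)) (R (frenetVector β (i + 1) t)) t :=
    fun t => hβ.deriv_frenetVector_of_skew hn hR hD hi t
  have hnorm : ∀ t, HasDerivAt (fun s => ‖deriv β s‖ ^ 2) 0 t := by
    intro t
    have h1 := hD 0 t
    simp only [zero_add, iteratedDeriv_one] at h1
    refine h1.norm_sq.congr_deriv ?_
    have h2 := hR (deriv β t) (deriv β t)
    rw [real_inner_comm] at h2
    linarith
  have hnum : ∀ t, HasDerivAt
      (fun s => (inner ℝ (R (frenetVector β i s)) (frenetVector β (i + 1) s) : ℝ)) 0 t := by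
    intro t
    have h1 := R.toContinuousLinearMap.hasFDerivAt.comp_hasDerivAt t (hd t)
    refine (h1.inner ℝ (hd' t)).congr_deriv ?_
    simp only [Function.comp_apply, LinearMap.coe_toContinuousLinearMap']
    rw [hR (R (frenetVector β i t)), add_neg_cancel]
  have e : ∀ t, frenetCurvature β i t =
      inner ℝ (R (frenetVector β i t)) (frenetVector β (i + 1) t) /
        Real.sqrt (‖deriv β t‖ ^ 2) := by
    intro t
    rw [frenetCurvature, (hd t).deriv, Real.sqrt_sq (norm_nonneg _)]
  refine ⟨frenetCurvature β i 0, fun t _ => ?_⟩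
  rw [e t, e 0]
  congr 1
  · exact is_const_of_deriv_eq_zero (fun s => (hnum s).differentiableAt) (fun s => (hnum s).deriv) t 0
  · congr 1
    exact is_const_of_deriv_eq_zero (fun s => (hnorm s).differentiableAt)
      (fun s => (hnorm s).deriv) t 0

end Homogeneous

/-! ### Coordinates by planes, plane rotations and linear differential equations. -/

section Torus

/-- The numbering of the coordinates of `ℝ^{2k}` by `k` planes. -/
def pairEquiv (k : ℕ) : Fin k × Fin 2 ≃ Fin (2 * k) :=
  finProdFinEquiv.trans (finCongr (mul_comm k 2))

theorem pairEquiv_val {k : ℕ} (l : Fin k) (b : Fin 2) :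
    ((pairEquiv k (l, b) : Fin (2 * k)) : ℕ) = b + 2 * l := by
  simp [pairEquiv]

theorem sum_pairs {k : ℕ} {M : Type*} [AddCommMonoid M] (g : Fin (2 * k) → M) :
    ∑ j, g j = ∑ l : Fin k, (g (pairEquiv k (l, 0)) + g (pairEquiv k (l, 1))) := by
  rw [← (pairEquiv k).sum_comp, Fintype.sum_prod_type]
  simp only [Fin.sum_univ_two]

theorem flatTorus_even {k : ℕ} (r u : Fin k → ℝ) (l : Fin k) :
    flatTorus r u (pairEquiv k (l, 0)) = r l * Real.cos (u l) := by
  have h1 := pairEquiv_val l 0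
  simp only [Fin.val_zero, zero_add] at h1
  simp [flatTorus, h1]

theorem flatTorus_odd {k : ℕ} (r u : Fin k → ℝ) (l : Fin k) :
    flatTorus r u (pairEquiv k (l, 1)) = r l * Real.sin (u l) := by
  have h1 := pairEquiv_val l 1
  have h2 : ((pairEquiv k (l, 1) : Fin (2 * k)) : ℕ) % 2 = 1 := by rw [h1]; simp [Nat.add_mod]
  have h3 : ((pairEquiv k (l, 1) : Fin (2 * k)) : ℕ) / 2 = l := by rw [h1]; simp; omega
  simp [flatTorus, h2, h3]

/-- The infinitesimal rotation with speeds `m` of the `k` coordinate planes of `ℝ^{2k}`. -/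
def planeRotation {k : ℕ} (m : Fin k → ℝ) :
    EuclideanSpace ℝ (Fin (2 * k)) →ₗ[ℝ] EuclideanSpace ℝ (Fin (2 * k)) where
  toFun x := WithLp.toLp 2 fun j =>
    if ((pairEquiv k).symm j).2 = 0 then
      -(m ((pairEquiv k).symm j).1 * x (pairEquiv k (((pairEquiv k).symm j).1, 1)))
    else m ((pairEquiv k).symm j).1 * x (pairEquiv k (((pairEquiv k).symm j).1, 0))
  map_add' x y := by
    ext j
    simp only [PiLp.add_apply]
    split_ifs <;> ring
  map_smul' c x := by
    ext j
    simp only [PiLp.smul_apply, smul_eq_mul, RingHom.id_apply]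
    split_ifs <;> ring

theorem planeRotation_even {k : ℕ} (m : Fin k → ℝ) (x : EuclideanSpace ℝ (Fin (2 * k)))
    (l : Fin k) : planeRotation m x (pairEquiv k (l, 0)) = -(m l * x (pairEquiv k (l, 1))) := by
  simp [planeRotation]

theorem planeRotation_odd {k : ℕ} (m : Fin k → ℝ) (x : EuclideanSpace ℝ (Fin (2 * k)))
    (l : Fin k) : planeRotation m x (pairEquiv k (l, 1)) = m l * x (pairEquiv k (l, 0)) := by
  simp [planeRotation]

theorem planeRotation_skew {k : ℕ} (m : Fin k → ℝ) (x y : EuclideanSpace ℝ (Fin (2 * k))) :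
    inner ℝ (planeRotation m x) y = -(inner ℝ x (planeRotation m y) : ℝ) := by
  simp only [PiLp.inner_apply, RCLike.inner_apply, conj_trivial, sum_pairs, planeRotation_even,
    planeRotation_odd, ← Finset.sum_neg_distrib]
  refine Finset.sum_congr rfl fun l _ => ?_
  ring

theorem hasDerivAt_of_coordinates {n : ℕ} {g : ℝ → EuclideanSpace ℝ (Fin n)}
    {g' : EuclideanSpace ℝ (Fin n)} {t : ℝ} (h : ∀ j, HasDerivAt (fun s => g s j) (g' j) t) :
    HasDerivAt g g' t :=
  (PiLp.continuousLinearEquiv 2 ℝ fun _ : Fin n => ℝ).symm.toContinuousLinearMap.hasFDerivAt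
    |>.comp_hasDerivAt t (hasDerivAt_pi.2 h)

theorem hasDerivAt_flatTorus {k : ℕ} (r m c : Fin k → ℝ) (t : ℝ) :
    HasDerivAt (fun s => flatTorus r (fun l => m l * s + c l))
      (planeRotation m (flatTorus r (fun l => m l * t + c l))) t := by
  refine hasDerivAt_of_coordinates fun j => ?_
  obtain ⟨⟨l, b⟩, rfl⟩ := (pairEquiv k).surjective j
  have h1 : HasDerivAt (fun s => m l * s + c l) (m l) t := by
    simpa using ((hasDerivAt_id t).const_mul (m l)).add_const (c l)
  fin_cases b
  · simp only [Fin.zero_eta, flatTorus_even, planeRotation_even, flatTorus_odd]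
    exact (h1.cos.const_mul (r l)).congr_deriv (by ring)
  · simp only [Fin.mk_one, flatTorus_even, planeRotation_odd, flatTorus_odd]
    exact (h1.sin.const_mul (r l)).congr_deriv (by ring)

variable {n : ℕ} {g : ℝ → EuclideanSpace ℝ (Fin n)}
  {R : EuclideanSpace ℝ (Fin n) →ₗ[ℝ] EuclideanSpace ℝ (Fin n)}

theorem iteratedDeriv_of_linear_ode (h : ∀ t, HasDerivAt g (R (g t)) t) (j : ℕ) (t : ℝ) :
    iteratedDeriv j g t = (R ^ j) (g t) ∧
      HasDerivAt (iteratedDeriv j g) (R (iteratedDeriv j g t)) t := by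
  have key : ∀ j, iteratedDeriv j g = fun t => (R ^ j) (g t) := by
    intro j
    induction j with
    | zero => funext t; simp
    | succ j ih =>
      funext t
      rw [iteratedDeriv_succ, ih]
      have := (R ^ j).toContinuousLinearMap.hasFDerivAt.comp_hasDerivAt t (h t)
      refine this.deriv.trans ?_
      simp [pow_succ]
  rw [key]
  refine ⟨rfl, ?_⟩
  have := (R ^ j).toContinuousLinearMap.hasFDerivAt.comp_hasDerivAt t (h t)
  refine this.congr_deriv ?_
  simp only [LinearMap.coe_toContinuousLinearMap']
  rw [← Module.End.mul_apply, ← pow_succ, pow_succ', Module.End.mul_apply]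

theorem contDiff_of_linear_ode (h : ∀ t, HasDerivAt g (R (g t)) t) (N : ℕ) : ContDiff ℝ N g :=
  contDiff_of_differentiable_iteratedDeriv fun j _ t =>
    (iteratedDeriv_of_linear_ode h j t).2.differentiableAt

end Torus

/-! ### Torus geodesics and their products with a line: constant curvatures and twistedness. -/

section TorusGeodesic

variable {k : ℕ} {γ : ℝ → EuclideanSpace ℝ (Fin (2 * k))}

theorem IsFlatTorusGeodesic.exists_rotation (hγ : IsFlatTorusGeodesic γ) :
    ∃ R : EuclideanSpace ℝ (Fin (2 * k)) →ₗ[ℝ] EuclideanSpace ℝ (Fin (2 * k)),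
      (∀ x y, inner ℝ (R x) y = -(inner ℝ x (R y) : ℝ)) ∧ ∀ t, HasDerivAt γ (R (γ t)) t := by
  obtain ⟨r, m, c, -, h⟩ := hγ
  refine ⟨planeRotation m, planeRotation_skew m, fun t => ?_⟩
  rw [h t, funext h]
  exact hasDerivAt_flatTorus r m c t

theorem IsFlatTorusGeodesic.hasConstantCurvatures (hk : 1 ≤ k) (hγ : IsFlatTorusGeodesic γ)
    (hF : IsFrenetCurve γ Set.univ) : HasConstantCurvatures γ Set.univ := by
  obtain ⟨R, hR, hd⟩ := hγ.exists_rotation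
  exact hF.hasConstantCurvatures_of_skew (by omega) hR
    fun j t => (iteratedDeriv_of_linear_ode hd (j + 1) t).2

/-- The inclusion of `ℝᵈ` in `ℝ^{d+1}`. -/
def snocZero (d : ℕ) : EuclideanSpace ℝ (Fin d) →ₗ[ℝ] EuclideanSpace ℝ (Fin (d + 1)) where
  toFun x := WithLp.toLp 2 (Fin.snoc (α := fun _ => ℝ) (fun j : Fin d => x j) 0)
  map_add' x y := by
    ext j
    refine Fin.lastCases ?_ (fun i => ?_) j <;> simp
  map_smul' c x := by
    ext j
    refine Fin.lastCases ?_ (fun i => ?_) j <;> simp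

/-- The projection of `ℝ^{d+1}` on `ℝᵈ`. -/
def initProj (d : ℕ) : EuclideanSpace ℝ (Fin (d + 1)) →ₗ[ℝ] EuclideanSpace ℝ (Fin d) where
  toFun x := WithLp.toLp 2 (fun j : Fin d => x j.castSucc)
  map_add' _ _ := rfl
  map_smul' _ _ := rfl

theorem snocZero_castSucc {d : ℕ} (x : EuclideanSpace ℝ (Fin d)) (j : Fin d) :
    snocZero d x j.castSucc = x j := by simp [snocZero]

theorem snocZero_last {d : ℕ} (x : EuclideanSpace ℝ (Fin d)) :
    snocZero d x (Fin.last d) = 0 := by simp [snocZero]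

theorem initProj_apply {d : ℕ} (x : EuclideanSpace ℝ (Fin (d + 1))) (j : Fin d) :
    initProj d x j = x j.castSucc := rfl

theorem initProj_snocZero {d : ℕ} (x : EuclideanSpace ℝ (Fin d)) :
    initProj d (snocZero d x) = x := by
  ext j
  rw [initProj_apply, snocZero_castSucc]

theorem initProj_single_last {d : ℕ} (a : ℝ) :
    initProj d (EuclideanSpace.single (Fin.last d) a) = 0 := by
  ext j
  simp [initProj_apply, Fin.castSucc_ne_last]

theorem inner_snocZero {d : ℕ} (x : EuclideanSpace ℝ (Fin d))
    (y : EuclideanSpace ℝ (Fin (d + 1))) :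
    inner ℝ (snocZero d x) y = (inner ℝ x (initProj d y) : ℝ) := by
  simp [PiLp.inner_apply, Fin.sum_univ_castSucc, snocZero_castSucc, snocZero_last, initProj_apply]

theorem timesLinear_eq {d : ℕ} (γ : ℝ → EuclideanSpace ℝ (Fin d)) (a t : ℝ) :
    timesLinear γ a t = snocZero d (γ t) + t • EuclideanSpace.single (Fin.last d) a := by
  ext j
  refine Fin.lastCases ?_ (fun i => ?_) j
  · simp [timesLinear, snocZero, mul_comm]
  · simp [timesLinear, snocZero]

/-- Extend `R` by zero on the new axis. The velocity alone has a nonzero last coordinate, `a`; the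
higher derivatives are images of the derivatives of `γ` under the injective map `R`, so all `2k + 1`
derivatives are independent. -/
theorem IsFlatTorusGeodesic.timesLinear (hk : 1 ≤ k) (hγ : IsFlatTorusGeodesic γ)
    (hT : IsTwistedCurve γ Set.univ) {a : ℝ} (ha : a ≠ 0) :
    IsTwistedCurve (timesLinear γ a) Set.univ ∧
      HasConstantCurvatures (timesLinear γ a) Set.univ := by
  obtain ⟨R, hR, hd⟩ := hγ.exists_rotation
  have hli := ((isTwistedCurve_iff (by omega) isOpen_univ).1 hT).2
  -- Every derivative of `γ` of positive order lies in the range of `R`, and the first `2k` of them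
  -- span because `γ` is twisted.
  have hRinj : Function.Injective R := by
    rw [LinearMap.injective_iff_surjective, ← LinearMap.range_eq_top, eq_top_iff,
      ← (hli 0 trivial).span_eq_top_of_card_eq_finrank' (by simp), Submodule.span_le]
    rintro _ ⟨j, rfl⟩
    refine ⟨(R ^ (j : ℕ)) (γ 0), ?_⟩
    simp only [(iteratedDeriv_of_linear_ode hd _ _).1, pow_succ', Module.End.mul_apply]
  set R' : EuclideanSpace ℝ (Fin (2 * k + 1)) →ₗ[ℝ] EuclideanSpace ℝ (Fin (2 * k + 1)) :=
    snocZero (2 * k) ∘ₗ R ∘ₗ initProj (2 * k) with hR'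
  have hskew : ∀ x y, inner ℝ (R' x) y = -(inner ℝ x (R' y) : ℝ) := by
    intro x y
    simp only [hR', LinearMap.comp_apply]
    rw [inner_snocZero, real_inner_comm (snocZero _ _) x, inner_snocZero, hR, real_inner_comm]
  have hd1 : ∀ t, HasDerivAt (_root_.timesLinear γ a)
      (snocZero _ (R (γ t)) + EuclideanSpace.single (Fin.last (2 * k)) a) t := by
    intro t
    rw [funext (timesLinear_eq γ a)]
    have h1 := (snocZero (2 * k)).toContinuousLinearMap.hasFDerivAt.comp_hasDerivAt t (hd t)
    have h2 := (hasDerivAt_id t).smul_const (EuclideanSpace.single (Fin.last (2 * k)) a)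
    exact (h1.add h2).congr_deriv (by simp)
  have hderiv : deriv (_root_.timesLinear γ a) =
      fun t => snocZero _ (R (γ t)) + EuclideanSpace.single (Fin.last (2 * k)) a :=
    funext fun t => (hd1 t).deriv
  -- The equation with `R'` holds for the velocity but not for the curve, since `R'` loses the
  -- constant drift `a`.
  have hd2 : ∀ t, HasDerivAt (deriv (_root_.timesLinear γ a))
      (R' (deriv (_root_.timesLinear γ a) t)) t := by
    intro t
    rw [hderiv]
    have h1 := (snocZero (2 * k) ∘ₗ R).toContinuousLinearMap.hasFDerivAt.comp_hasDerivAt t (hd t)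
    refine (h1.add_const (EuclideanSpace.single (Fin.last (2 * k)) a)).congr_deriv ?_
    simp [hR', initProj_snocZero, initProj_single_last]
  have hD : ∀ j t, HasDerivAt (iteratedDeriv (j + 1) (_root_.timesLinear γ a))
      (R' (iteratedDeriv (j + 1) (_root_.timesLinear γ a) t)) t := by
    intro j t
    rw [iteratedDeriv_succ']
    exact (iteratedDeriv_of_linear_ode hd2 j t).2
  have hiter : ∀ j t, iteratedDeriv (j + 2) (_root_.timesLinear γ a) t =
      snocZero _ (R (iteratedDeriv (j + 1) γ t)) := by
    intro j t
    induction j generalizing t with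
    | zero =>
      rw [iteratedDeriv_succ, (hD 0 t).deriv]
      simp only [zero_add, iteratedDeriv_one]
      rw [hderiv, (hd t).deriv]
      simp [hR', initProj_snocZero, initProj_single_last]
    | succ j ih =>
      rw [iteratedDeriv_succ, (hD (j + 1) t).deriv, ih,
        iteratedDeriv_succ (n := j + 1), (iteratedDeriv_of_linear_ode hd (j + 1) t).2.deriv]
      simp [hR', initProj_snocZero]
  have hT' : IsTwistedCurve (_root_.timesLinear γ a) Set.univ := by
    rw [isTwistedCurve_iff (by omega) isOpen_univ]
    constructor
    · rw [contDiffOn_univ, funext (timesLinear_eq γ a)]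
      have h1 := contDiff_of_linear_ode hd (2 * k + 1)
      exact ((snocZero (2 * k)).toContinuousLinearMap.contDiff.comp h1).add
        (contDiff_id.smul contDiff_const)
    · intro t _
      rw [linearIndependent_finSucc]
      have htail : (Fin.tail fun j : Fin (2 * k + 1) =>
          iteratedDeriv ((j : ℕ) + 1) (_root_.timesLinear γ a) t) =
          fun j : Fin (2 * k) => (snocZero _ ∘ₗ R) (iteratedDeriv ((j : ℕ) + 1) γ t) := by
        funext j
        simp only [Fin.tail, Fin.val_succ, LinearMap.comp_apply]
        exact hiter j t
      rw [htail]
      constructor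
      · refine (hli t trivial).map' _ (LinearMap.ker_eq_bot.2 ?_)
        exact (Function.LeftInverse.injective initProj_snocZero).comp hRinj
      · intro hmem
        have hle : Submodule.span ℝ (Set.range fun j : Fin (2 * k) =>
            (snocZero _ ∘ₗ R) (iteratedDeriv ((j : ℕ) + 1) γ t)) ≤
            LinearMap.ker (innerSL ℝ (EuclideanSpace.single (Fin.last (2 * k)) (1 : ℝ))).toLinearMap := by
          rw [Submodule.span_le]
          rintro _ ⟨j, rfl⟩
          simp [EuclideanSpace.inner_single_left, snocZero_last]
        have := hle hmem
        simp [hderiv, EuclideanSpace.inner_single_left, snocZero_last] at this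
        exact ha this
  exact ⟨hT', hT'.1.hasConstantCurvatures_of_skew (by omega) hskew hD⟩

/-- The geodesics of a flat torus with distinct positive frequencies are twisted. -/
theorem isTwistedCurve_flatTorus (hk : 1 ≤ k) {r m c : Fin k → ℝ} (hr : ∀ l, 0 < r l)
    (hm : ∀ l, 0 < m l) (hinj : Function.Injective m) :
    IsTwistedCurve (fun t => flatTorus r (fun l => m l * t + c l)) Set.univ := by
  have hd := hasDerivAt_flatTorus r m c
  rw [isTwistedCurve_iff (by omega) isOpen_univ]
  refine ⟨(contDiff_of_linear_ode hd (2 * k)).contDiffOn, fun t _ => ?_⟩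
  simp only [(iteratedDeriv_of_linear_ode hd _ _).1]
  set x := flatTorus r (fun l => m l * t + c l) with hx
  -- Each coordinate plane is read as `ℂ`, where the infinitesimal rotation is multiplication by `m
  -- l * I`.
  set z : Fin k → EuclideanSpace ℝ (Fin (2 * k)) → ℂ := fun l y =>
    ⟨y (pairEquiv k (l, 0)), y (pairEquiv k (l, 1))⟩ with hz
  have hz0 : ∀ l, z l x ≠ 0 := by
    intro l h0
    have h1 := congrArg Complex.re h0
    have h2 := congrArg Complex.im h0
    simp only [hz, hx, flatTorus_even, flatTorus_odd, Complex.zero_re, Complex.zero_im,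
      mul_eq_zero, (hr l).ne', false_or] at h1 h2
    have := Real.sin_sq_add_cos_sq (m l * t + c l)
    rw [h1, h2] at this
    norm_num at this
  have hzR : ∀ l y, z l (planeRotation m y) = (m l * Complex.I) * z l y := by
    intro l y
    apply Complex.ext <;> simp [hz, planeRotation_even, planeRotation_odd]
  have hzpow : ∀ l j, z l ((planeRotation m ^ j) x) = (m l * Complex.I) ^ j * z l x := by
    intro l j
    induction j with
    | zero => simp
    | succ j ih => rw [pow_succ', Module.End.mul_apply, hzR, ih]; ring
  have hzsum : ∀ l (s : Finset (Fin (2 * k))) (c : Fin (2 * k) → ℝ)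
      (y : Fin (2 * k) → EuclideanSpace ℝ (Fin (2 * k))),
      z l (∑ j ∈ s, c j • y j) = ∑ j ∈ s, (c j : ℂ) * z l (y j) := by
    intro l s c y
    apply Complex.ext <;> simp [hz]
  rw [Fintype.linearIndependent_iff]
  intro b hb
  -- A linear relation among the derivatives becomes a polynomial of degree below `2k` vanishing at
  -- the `2k` distinct numbers `± m l * I`; conjugate roots come from the real coefficients.
  set q : Polynomial ℂ := ∑ j : Fin (2 * k), Polynomial.C (b j : ℂ) * Polynomial.X ^ (j : ℕ)
    with hq
  have heval : ∀ w : ℂ, q.eval w = ∑ j : Fin (2 * k), (b j : ℂ) * w ^ (j : ℕ) := by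
    intro w
    simp [hq, Polynomial.eval_finsetSum]
  have hroot : ∀ l, q.eval (m l * Complex.I) = 0 := by
    intro l
    have h1 := congrArg (z l) hb
    rw [hzsum] at h1
    have h2 : (m l * Complex.I) * z l x ≠ 0 :=
      mul_ne_zero (mul_ne_zero (by exact_mod_cast (hm l).ne') Complex.I_ne_zero) (hz0 l)
    have h3 : z l 0 = 0 := by apply Complex.ext <;> simp [hz]
    rw [h3] at h1
    refine (mul_eq_zero.1 ?_).resolve_right h2
    rw [heval, Finset.sum_mul, ← h1]
    refine Finset.sum_congr rfl fun j _ => ?_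
    rw [hzpow]
    ring
  have hroot' : ∀ l, q.eval (-(m l * Complex.I)) = 0 := by
    intro l
    have h1 := congrArg (starRingEnd ℂ) (hroot l)
    rw [heval, map_sum] at h1
    simp only [map_mul, map_pow, Complex.conj_ofReal, Complex.conj_I, map_zero] at h1
    rw [heval, ← h1]
    refine Finset.sum_congr rfl fun j _ => ?_
    rw [mul_neg]
  have hq0 : q = 0 := by
    refine Polynomial.eq_zero_of_degree_lt_of_eval_finset_eq_zero
      (Finset.univ.image (Sum.elim (fun l => (m l * Complex.I : ℂ)) fun l => -(m l * Complex.I)))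
      ?_ ?_
    · rw [Finset.card_image_of_injective]
      · have := Polynomial.degree_sum_fin_lt (fun j : Fin (2 * k) => (b j : ℂ))
        refine this.trans_le ?_
        simp [two_mul]
      · have hI : ∀ u v : ℝ, (u * Complex.I : ℂ) = v * Complex.I → u = v := by
          intro u v h
          simpa using congrArg Complex.im h
        rintro (l | l) (l' | l') h
        · simp only [Sum.elim_inl] at h
          rw [hinj (hI _ _ h)]
        · simp only [Sum.elim_inl, Sum.elim_inr, ← neg_mul] at h
          have := hI (m l) (-m l') (by push_cast; exact h)
          linarith [hm l, hm l']
        · simp only [Sum.elim_inl, Sum.elim_inr, ← neg_mul] at h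
          have := hI (-m l) (m l') (by push_cast; exact h)
          linarith [hm l, hm l']
        · simp only [Sum.elim_inr, neg_inj] at h
          rw [hinj (hI _ _ h)]
    · intro w hw
      obtain ⟨(l | l), -, rfl⟩ := Finset.mem_image.1 hw
      · exact hroot l
      · exact hroot' l
  intro j
  have h1 := congrArg (fun p => Polynomial.coeff p (j : ℕ)) hq0
  simp only [hq, Polynomial.finsetSum_coeff, Polynomial.coeff_C_mul, Polynomial.coeff_X_pow,
    Polynomial.coeff_zero] at h1
  rw [Finset.sum_eq_single j] at h1
  · simpa using h1
  · intro i _ hij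
    have : (j : ℕ) ≠ i := fun e => hij (Fin.ext e.symm)
    simp [this]
  · simp

end TorusGeodesic

/-! ### Normal form of a skew-symmetric map with a cyclic vector. -/

section Spectral

variable {E : Type*} [NormedAddCommGroup E] [InnerProductSpace ℝ E] {T : E →ₗ[ℝ] E}

theorem inner_skew_self (hT : ∀ x y, inner ℝ (T x) y = -(inner ℝ x (T y) : ℝ)) (x : E) :
    inner ℝ x (T x) = (0 : ℝ) := by
  have h1 := hT x x
  rw [real_inner_comm] at h1
  linarith

/-- A vector is a sum of a kernel vector and of finitely many nonzero vectors on which the square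
of a given skew-symmetric map acts as distinct negative numbers. -/
theorem exists_skew_decomposition [FiniteDimensional ℝ E]
    (hT : ∀ x y, inner ℝ (T x) y = -(inner ℝ x (T y) : ℝ)) (v : E) :
    ∃ (K : ℕ) (m : Fin K → ℝ) (u : Fin K → E) (v₀ : E), (∀ l, 0 < m l) ∧ Function.Injective m ∧
      (∀ l, u l ≠ 0) ∧ (∀ l, T (T (u l)) = -((m l ^ 2) • u l)) ∧ T v₀ = 0 ∧
      v = v₀ + ∑ l, u l := by
  classical
  set S : E →ₗ[ℝ] E := -(T ∘ₗ T) with hS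
  have hsym : S.IsSymmetric := by
    intro x y
    simp only [hS, LinearMap.neg_apply, LinearMap.comp_apply, inner_neg_left, inner_neg_right, hT,
      neg_neg]
  set b := hsym.eigenvectorBasis rfl
  set ev := hsym.eigenvalues rfl
  have hb : ∀ i, T (T (b i)) = -(ev i • b i) := by
    intro i
    have h1 := hsym.apply_eigenvectorBasis rfl i
    change S (b i) = (ev i : ℝ) • b i at h1
    rw [← h1]
    simp [hS]
  have hev : ∀ i, ev i = ‖T (b i)‖ ^ 2 := by
    intro i
    rw [← real_inner_self_eq_norm_sq, hT, hb, inner_neg_right, neg_neg, inner_smul_right,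
      real_inner_self_eq_norm_sq, b.orthonormal.1 i]
    simp
  -- The symmetric map `-T²` has eigenvalue `‖T (b i)‖ ^ 2` at `b i`, so this norm is the rotation
  -- speed. Grouping the expansion of `v` by speed gives `U`, with a single vector for each speed
  -- whatever its multiplicity.
  set fr : Fin (Module.finrank ℝ E) → ℝ := fun i => ‖T (b i)‖ with hfr
  set U : ℝ → E := fun μ => ∑ i with fr i = μ, (inner ℝ (b i) v : ℝ) • b i with hU
  have hTU : ∀ μ, T (T (U μ)) = -((μ ^ 2) • U μ) := by
    intro μ
    simp only [hU, map_sum, map_smul, Finset.smul_sum, ← Finset.sum_neg_distrib]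
    refine Finset.sum_congr rfl fun i hi => ?_
    have h1 : ‖T (b i)‖ = μ := (Finset.mem_filter.1 hi).2
    rw [hb, hev, h1, smul_neg, smul_comm]
  have hU0 : T (U 0) = 0 := by
    simp only [hU, map_sum, map_smul]
    refine Finset.sum_eq_zero fun i hi => ?_
    have h1 : ‖T (b i)‖ = 0 := (Finset.mem_filter.1 hi).2
    rw [norm_eq_zero.1 h1, smul_zero]
  set s : Finset ℝ := (Finset.univ.image fr).filter fun μ => 0 < μ ∧ U μ ≠ 0 with hs
  have hv : v = U 0 + ∑ μ ∈ s, U μ := by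
    have h1 : v = ∑ μ ∈ insert 0 (Finset.univ.image fr), U μ := by
      rw [Finset.sum_fiberwise_of_maps_to (fun i _ => Finset.mem_insert_of_mem
        (Finset.mem_image_of_mem fr (Finset.mem_univ i)))]
      exact (b.sum_repr' v).symm
    have h2 : insert 0 s ⊆ insert 0 (Finset.univ.image fr) :=
      Finset.insert_subset_insert _ (Finset.filter_subset _ _)
    rw [← Finset.sum_insert (by simp [hs]), Finset.sum_subset h2, ← h1]
    intro μ hμ hμ'
    by_contra h0
    apply hμ'
    rcases Finset.mem_insert.1 hμ with rfl | h3
    · exact Finset.mem_insert_self _ _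
    · by_cases h4 : μ = 0
      · rw [h4]; exact Finset.mem_insert_self _ _
      · refine Finset.mem_insert_of_mem (Finset.mem_filter.2 ⟨h3, ?_, h0⟩)
        obtain ⟨i, -, rfl⟩ := Finset.mem_image.1 h3
        exact lt_of_le_of_ne (norm_nonneg _) (Ne.symm h4)
  refine ⟨s.card, fun l => s.equivFin.symm l, fun l => U (s.equivFin.symm l), U 0,
    fun l => (Finset.mem_filter.1 (s.equivFin.symm l).2).2.1,
    Subtype.val_injective.comp s.equivFin.symm.injective,
    fun l => (Finset.mem_filter.1 (s.equivFin.symm l).2).2.2, fun l => hTU _, hU0, ?_⟩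
  rw [s.equivFin.symm.sum_comp (fun x : s => U x), Finset.sum_coe_sort s U]
  exact hv

theorem inner_eq_zero_of_skew_sq (hT : ∀ x y, inner ℝ (T x) y = -(inner ℝ x (T y) : ℝ))
    {x y : E} {a b : ℝ} (hab : a ≠ b) (hx : T (T x) = -(a • x)) (hy : T (T y) = -(b • y)) :
    inner ℝ x y = (0 : ℝ) := by
  have h1 : (inner ℝ (T (T x)) y : ℝ) = inner ℝ x (T (T y)) := by rw [hT, hT, neg_neg]
  rw [hx, hy, inner_neg_left, inner_neg_right, inner_smul_left, inner_smul_right] at h1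
  simp only [conj_trivial] at h1
  have h2 : (a - b) * (inner ℝ x y : ℝ) = 0 := by linarith
  exact (mul_eq_zero.1 h2).resolve_left (sub_ne_zero.2 hab)

/-- Normal form of a skew-symmetric map with a cyclic vector: it is a rotation with distinct
positive speeds in orthogonal planes, which together with the kernel component of the cyclic
vector span the space. -/
theorem exists_skew_normal_form [FiniteDimensional ℝ E]
    (hT : ∀ x y, inner ℝ (T x) y = -(inner ℝ x (T y) : ℝ)) {v : E}
    (hv : ∀ W : Submodule ℝ E, v ∈ W → (∀ x ∈ W, T x ∈ W) → W = ⊤) :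
    ∃ (K : ℕ) (m ρ : Fin K → ℝ) (g : Fin K × Fin 2 → E) (v₀ : E), (∀ l, 0 < m l) ∧
      Function.Injective m ∧ (∀ l, 0 < ρ l) ∧ Orthonormal ℝ g ∧
      (∀ l, T (g (l, 0)) = m l • g (l, 1)) ∧ (∀ l, T (g (l, 1)) = -(m l • g (l, 0))) ∧
      T v₀ = 0 ∧ v = v₀ + ∑ l, ρ l • g (l, 1) ∧ (∀ p, inner ℝ (g p) v₀ = (0 : ℝ)) ∧
      Submodule.span ℝ (insert v₀ (Set.range g)) = ⊤ := by
  obtain ⟨K, m, u, v₀, hm, hinj, hu, hTu, hv₀, hsum⟩ := exists_skew_decomposition hT v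
  -- The plane of speed `m l` is spanned by the normalized component `B l` of `v` and by `A l`,
  -- scaled so that `T (A l) = m l • B l` and `T (B l) = -(m l • A l)`.
  set B : Fin K → E := fun l => (‖u l‖⁻¹ : ℝ) • u l with hB
  set A : Fin K → E := fun l => -((m l)⁻¹ • T (B l)) with hA
  have hTB : ∀ l, T (B l) = -(m l • A l) := by
    intro l
    have := (hm l).ne'
    simp only [hA, smul_neg, neg_neg, smul_smul]
    rw [mul_inv_cancel₀ this, one_smul]
  have hTTB : ∀ l, T (T (B l)) = -((m l ^ 2) • B l) := by
    intro l
    simp only [hB, map_smul, hTu, smul_neg]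
    rw [smul_comm]
  have hTA : ∀ l, T (A l) = m l • B l := by
    intro l
    have := (hm l).ne'
    simp only [hA, map_neg, map_smul, hTTB, smul_neg, neg_neg, smul_smul]
    congr 1
    field_simp
  have hTTA : ∀ l, T (T (A l)) = -((m l ^ 2) • A l) := by
    intro l
    rw [hTA, map_smul, hTB, smul_neg, smul_smul, sq]
  have hBn : ∀ l, ‖B l‖ = 1 := fun l => norm_smul_inv_norm (hu l)
  have hAn : ∀ l, ‖A l‖ = 1 := by
    intro l
    have h1 : ‖T (B l)‖ ^ 2 = m l ^ 2 := by
      rw [← real_inner_self_eq_norm_sq, hT, hTTB, inner_neg_right, neg_neg, inner_smul_right,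
        real_inner_self_eq_norm_sq, hBn]
      ring
    have h2 : ‖T (B l)‖ = m l :=
      (sq_eq_sq₀ (norm_nonneg _) (hm l).le).1 h1
    have := (hm l).ne'
    simp only [hA, norm_neg, norm_smul, h2, norm_inv, Real.norm_of_nonneg (hm l).le]
    exact inv_mul_cancel₀ this
  set g : Fin K × Fin 2 → E := fun p => if p.2 = 0 then A p.1 else B p.1 with hg
  have hTTg : ∀ p, T (T (g p)) = -((m p.1 ^ 2) • g p) := by
    intro p
    simp only [hg]
    split_ifs
    · exact hTTA _
    · exact hTTB _
  have hAB : ∀ l, inner ℝ (A l) (B l) = (0 : ℝ) := by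
    intro l
    simp only [hA, inner_neg_left, inner_smul_left]
    rw [real_inner_comm, inner_skew_self hT]
    simp
  have hon : Orthonormal ℝ g := by
    refine ⟨fun p => ?_, fun p q hpq => ?_⟩
    · simp only [hg]
      split_ifs
      · exact hAn _
      · exact hBn _
    · change inner ℝ (g p) (g q) = 0
      by_cases h1 : p.1 = q.1
      · obtain ⟨l, i⟩ := p
        obtain ⟨l', j⟩ := q
        simp only at h1
        subst h1
        have hij : i ≠ j := fun e => hpq (by rw [e])
        simp only [hg]
        split_ifs with h2 h3 h3
        · exact absurd (h2.trans h3.symm) hij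
        · exact hAB l
        · rw [real_inner_comm]; exact hAB l
        · omega
      · refine inner_eq_zero_of_skew_sq hT ?_ (hTTg p) (hTTg q)
        intro e
        exact h1 (hinj ((sq_eq_sq₀ (hm _).le (hm _).le).1 e))
  have hsum' : v = v₀ + ∑ l, ‖u l‖ • g (l, 1) := by
    rw [hsum]
    congr 1
    refine Finset.sum_congr rfl fun l _ => ?_
    simp only [hg, hB]
    rw [if_neg (by simp), smul_smul, mul_inv_cancel₀ (norm_ne_zero_iff.2 (hu l)), one_smul]
  refine ⟨K, m, fun l => ‖u l‖, g, v₀, hm, hinj, fun l => norm_pos_iff.2 (hu l), hon,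
    fun l => ?_, fun l => ?_, hv₀, hsum', fun p => ?_, ?_⟩
  · simpa [hg] using hTA l
  · simpa [hg] using hTB l
  · refine inner_eq_zero_of_skew_sq hT (pow_pos (hm p.1) 2).ne' (hTTg p) (b := 0) ?_
    simp [hv₀]
  · have hgm : ∀ p, g p ∈ Submodule.span ℝ (insert v₀ (Set.range g)) := fun p =>
      Submodule.subset_span (Set.mem_insert_of_mem _ ⟨p, rfl⟩)
    -- Cyclicity: the span of the planes and `v₀` contains `v` and is stable under `T`, so it is the
    -- whole space.
    refine hv _ ?_ ?_
    · rw [hsum']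
      exact Submodule.add_mem _ (Submodule.subset_span (Set.mem_insert _ _))
        (Submodule.sum_mem _ fun l _ => Submodule.smul_mem _ _ (hgm _))
    · intro x hx
      have hle : Submodule.span ℝ (insert v₀ (Set.range g)) ≤
          (Submodule.span ℝ (insert v₀ (Set.range g))).comap T := by
        refine Submodule.span_le.2 ?_
        rintro y (rfl | ⟨⟨l, i⟩, rfl⟩)
        · simp [hv₀]
        · change T (g (l, i)) ∈ Submodule.span ℝ (insert v₀ (Set.range g))
          by_cases hi : i = 0
          · subst hi
            have : T (g (l, 0)) = m l • g (l, 1) := by simpa [hg] using hTA l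
            rw [this]
            exact Submodule.smul_mem _ _ (hgm _)
          · obtain rfl : i = 1 := by omega
            have : T (g (l, 1)) = -(m l • g (l, 0)) := by simpa [hg] using hTB l
            rw [this]
            exact Submodule.neg_mem _ (Submodule.smul_mem _ _ (hgm _))
      exact hle hx

end Spectral

/-! ### Integrating rotations of variable speed, and the arc length. -/

section Integration

variable {F : Type*} [NormedAddCommGroup F] [NormedSpace ℝ F] {I : Set ℝ}

theorem eq_of_hasDerivAt_zero (hI : IsOpen I) (hIc : IsPreconnected I) {g : ℝ → F}
    (h : ∀ t ∈ I, HasDerivAt g 0 t) {s t : ℝ} (hs : s ∈ I) (ht : t ∈ I) : g s = g t :=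
  hI.is_const_of_deriv_eq_zero hIc (fun x hx => (h x hx).differentiableAt.differentiableWithinAt)
    (fun x hx => (h x hx).deriv) hs ht

/-- Solution of the equations of a rotation with the variable speed `m φ'`. -/
theorem eq_of_rotation_equations (hI : IsOpen I) (hIc : IsPreconnected I) {φ w : ℝ → ℝ}
    {P Q : ℝ → F} {m t₀ : ℝ} (ht₀ : t₀ ∈ I) (hφ₀ : φ t₀ = 0)
    (hφ : ∀ t ∈ I, HasDerivAt φ (w t) t) (hP : ∀ t ∈ I, HasDerivAt P (w t • m • Q t) t)
    (hQ : ∀ t ∈ I, HasDerivAt Q (-(w t • m • P t)) t) {t : ℝ} (ht : t ∈ I) :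
    P t = Real.cos (m * φ t) • P t₀ + Real.sin (m * φ t) • Q t₀ := by
  have hθ : ∀ t ∈ I, HasDerivAt (fun s => m * φ s) (m * w t) t := fun t ht => (hφ t ht).const_mul m
  -- Rotating the pair `(P, Q)` back by the angle `m * φ` makes it constant; solving for `P` then
  -- uses `sin² + cos² = 1`.
  have hX : ∀ t ∈ I, HasDerivAt
      (fun s => Real.cos (m * φ s) • P s - Real.sin (m * φ s) • Q s) 0 t := by
    intro t ht
    refine (((hθ t ht).cos.fun_smul (hP t ht)).fun_sub
      ((hθ t ht).sin.fun_smul (hQ t ht))).congr_deriv ?_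
    module
  have hY : ∀ t ∈ I, HasDerivAt
      (fun s => Real.sin (m * φ s) • P s + Real.cos (m * φ s) • Q s) 0 t := by
    intro t ht
    refine (((hθ t ht).sin.fun_smul (hP t ht)).fun_add
      ((hθ t ht).cos.fun_smul (hQ t ht))).congr_deriv ?_
    module
  have h1 := eq_of_hasDerivAt_zero hI hIc hX ht ht₀
  have h2 := eq_of_hasDerivAt_zero hI hIc hY ht ht₀
  simp only [hφ₀, mul_zero, Real.cos_zero, Real.sin_zero, one_smul, zero_smul, sub_zero,
    zero_add] at h1 h2
  rw [← h1, ← h2]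
  have h3 := Real.sin_sq_add_cos_sq (m * φ t)
  calc P t = (Real.sin (m * φ t) ^ 2 + Real.cos (m * φ t) ^ 2) • P t := by rw [h3, one_smul]
    _ = _ := by module

/-- The arc length, as a `C^n` parameter. -/
theorem exists_primitive (hI : IsOpen I) (hIc : I.OrdConnected) {w : ℝ → ℝ} {n : ℕ}
    (hw : ContDiffOn ℝ n w I) {t₀ : ℝ} (ht₀ : t₀ ∈ I) :
    ∃ φ : ℝ → ℝ, φ t₀ = 0 ∧ (∀ t ∈ I, HasDerivAt φ (w t) t) ∧
      ContDiffOn ℝ (n + 1 : ℕ) φ I := by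
  have hd : ∀ t ∈ I, HasDerivAt (fun u => ∫ x in t₀..u, w x) (w t) t := by
    intro t ht
    refine intervalIntegral.integral_hasDerivAt_right ?_ ?_ ?_
    · exact (hw.continuousOn.mono (hIc.uIcc_subset ht₀ ht)).intervalIntegrable
    · exact hw.continuousOn.stronglyMeasurableAtFilter hI t ht
    · exact hw.continuousOn.continuousAt (hI.mem_nhds ht)
  refine ⟨_, intervalIntegral.integral_same, hd, ?_⟩
  push_cast
  rw [contDiffOn_succ_iff_deriv_of_isOpen hI]
  refine ⟨fun t ht => (hd t ht).differentiableAt.differentiableWithinAt, by simp, ?_⟩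
  exact hw.congr fun t ht => (hd t ht).deriv

end Integration

/-! ### Explicit integration of the Frenet equations with constant curvatures. -/

section ConstantCurvatures

variable {n : ℕ} {α : ℝ → EuclideanSpace ℝ (Fin n)} {I : Set ℝ}

/-- A skew tridiagonal matrix is determined by its superdiagonal, here the curvatures. -/
theorem HasConstantCurvatures.frenetMatrix_eq (hc : HasConstantCurvatures α I)
    (h : IsFrenetCurve α I) (hn : 2 ≤ n) (hI : IsOpen I) {s t : ℝ} (hs : s ∈ I) (ht : t ∈ I)
    {i j : ℕ} (hi : i < n) (hj : j < n) : frenetMatrix α i j s = frenetMatrix α i j t := by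
  have S := h.frenetSystem hn hI
  have hcurv : ∀ i, i + 1 < n → frenetMatrix α i (i + 1) s = frenetMatrix α i (i + 1) t := by
    intro i hi
    obtain ⟨c, hc⟩ := hc i hi
    rw [← frenetCurvature_eq_frenetMatrix, ← frenetCurvature_eq_frenetMatrix, hc s hs, hc t ht]
  have hlt : ∀ i j, i < j → j < n → frenetMatrix α i j s = frenetMatrix α i j t := by
    intro i j hij hj
    by_cases h1 : j = i + 1
    · subst h1
      exact hcurv i hj
    · rw [S.tridiagonal s hs i j (by omega) hj, S.tridiagonal t ht i j (by omega) hj]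
  rcases lt_trichotomy i j with h1 | rfl | h1
  · exact hlt i j h1 hj
  · have h1 := S.skew s hs i hi i hi
    have h2 := S.skew t ht i hi i hi
    linarith
  · rw [S.skew s hs i hi j hj, S.skew t ht i hi j hj, hlt j i h1 hi]

/-- The explicit form of a twisted curve with constant curvatures. -/
theorem IsTwistedCurve.exists_explicit_form (hn : 2 ≤ n) (hI : IsOpen I) (hIc : I.OrdConnected)
    (hIn : I.Nonempty) (hα : IsTwistedCurve α I) (hc : HasConstantCurvatures α I) :
    ∃ (K : ℕ) (m r : Fin K → ℝ) (g : Fin K × Fin 2 → EuclideanSpace ℝ (Fin n))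
      (v₀ C : EuclideanSpace ℝ (Fin n)) (φ : ℝ → ℝ),
      (∀ l, 0 < m l) ∧ Function.Injective m ∧ (∀ l, 0 < r l) ∧ Orthonormal ℝ g ∧
      (∀ p, inner ℝ (g p) v₀ = (0 : ℝ)) ∧
      Submodule.span ℝ (insert v₀ (Set.range g)) = ⊤ ∧
      ContDiffOn ℝ n φ I ∧ (∀ t ∈ I, 0 < deriv φ t) ∧
      ∀ t ∈ I, α t = C + (φ t • v₀ + ∑ l, ((r l * Real.cos (m l * φ t)) • g (l, 0) +
        (r l * Real.sin (m l * φ t)) • g (l, 1))) := by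
  obtain ⟨t₀, ht₀⟩ := hIn
  have hF := hα.1
  have S := hF.frenetSystem hn hI
  have hpre : IsPreconnected I := hIc.isPreconnected
  set e₀ : ℕ → EuclideanSpace ℝ (Fin n) := fun i => frenetVector α i t₀ with he₀
  have hon : Orthonormal ℝ (fun i : Fin n => e₀ i) := S.orthonormal t₀ ht₀
  set k : ℕ → ℕ → ℝ := fun i j => frenetMatrix α i j t₀ with hk
  set T : EuclideanSpace ℝ (Fin n) →ₗ[ℝ] EuclideanSpace ℝ (Fin n) :=
    ∑ i : Fin n, ∑ j : Fin n,
      k i j • ((innerSL ℝ (e₀ i)).toLinearMap.smulRight (e₀ j)) with hTdef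
  have hTapp : ∀ x, T x = ∑ i : Fin n, ∑ j : Fin n, (k i j * inner ℝ (e₀ i) x) • e₀ j := by
    intro x
    simp [hTdef, LinearMap.sum_apply, smul_smul]
  have hskew : ∀ x y, inner ℝ (T x) y = -(inner ℝ x (T y) : ℝ) := by
    intro x y
    simp only [hTapp, sum_inner, inner_sum, inner_smul_left, inner_smul_right, conj_trivial,
      ← Finset.sum_neg_distrib]
    rw [Finset.sum_comm]
    refine Finset.sum_congr rfl fun i _ => Finset.sum_congr rfl fun j _ => ?_
    have h1 : k j i = -k i j := S.skew t₀ ht₀ j j.2 i i.2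
    rw [h1, real_inner_comm x (e₀ j)]
    ring
  have hTe : ∀ i, i < n → T (e₀ i) = ∑ j : Fin n, k i j • e₀ j := by
    intro i hi
    rw [hTapp, Finset.sum_eq_single (⟨i, hi⟩ : Fin n)]
    · simp only [hon.inner_nat hi hi, if_true, mul_one]
    · intro l _ hl
      have hl' : (l : ℕ) ≠ i := fun e => hl (Fin.ext e)
      refine Finset.sum_eq_zero fun j _ => ?_
      rw [hon.inner_nat l.2 hi, if_neg hl']
      simp
    · simp
  -- `T e_i` is `k i (i+1) • e_{i+1}` plus earlier frame vectors, and that coefficient is nonzero: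
  -- the lower curvatures are positive, the last one is nonzero by twistedness. So `e_0` generates
  -- every `e_i`.
  have hcyc : ∀ W : Submodule ℝ (EuclideanSpace ℝ (Fin n)), e₀ 0 ∈ W →
      (∀ x ∈ W, T x ∈ W) → W = ⊤ := by
    intro W h0 hW
    have hmem : ∀ i, i < n → e₀ i ∈ W := by
      intro i
      induction i using Nat.strong_induction_on with
      | _ i ih =>
      intro hi
      rcases Nat.eq_zero_or_pos i with rfl | hpos
      · exact h0
      obtain ⟨i, rfl⟩ : ∃ i', i = i' + 1 := ⟨i - 1, by omega⟩
      have h1 := hW _ (ih i (by omega) (by omega))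
      rw [hTe i (by omega), ← Finset.add_sum_erase _ _ (Finset.mem_univ (⟨i + 1, hi⟩ : Fin n))] at h1
      have h2 : ∑ j ∈ Finset.univ.erase (⟨i + 1, hi⟩ : Fin n), k i j • e₀ j ∈ W := by
        refine Submodule.sum_mem _ fun j hj => ?_
        have hj' : (j : ℕ) ≠ i + 1 := fun e => (Finset.mem_erase.1 hj).1 (Fin.ext e)
        rcases lt_or_gt_of_ne hj' with hlt | hgt
        · exact Submodule.smul_mem _ _ (ih j hlt j.2)
        · have : k i j = 0 := S.tridiagonal t₀ ht₀ i j hgt j.2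
          rw [this, zero_smul]
          exact Submodule.zero_mem _
      have h3 : k i (i + 1) ≠ 0 := by
        by_cases h4 : i + 2 < n
        · exact (S.pos t₀ ht₀ i h4).ne'
        · have := hα.2 t₀ ht₀
          rwa [show n - 2 = i by omega] at this
      exact (Submodule.smul_mem_iff _ h3).1 ((Submodule.add_mem_iff_left _ h2).1 h1)
    rw [eq_top_iff]
    intro x _
    rw [hon.eq_sum x]
    exact Submodule.sum_mem _ fun i _ => Submodule.smul_mem _ _ (hmem i i.2)
  -- `L t` sends the frame at `t₀` to the frame at `t`. Constancy of the Frenet matrix turns the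
  -- Frenet equations into `(L t x)' = ‖α'‖ • L t (T x)`.
  set L : ℝ → EuclideanSpace ℝ (Fin n) → EuclideanSpace ℝ (Fin n) :=
    fun t x => ∑ i : Fin n, (inner ℝ (e₀ i) x : ℝ) • frenetVector α i t with hL
  have hLadd : ∀ t x y, L t (x + y) = L t x + L t y := by
    intro t x y
    simp [hL, inner_add_right, add_smul, Finset.sum_add_distrib]
  have hLsmul : ∀ t (a : ℝ) x, L t (a • x) = a • L t x := by
    intro t a x
    simp [hL, inner_smul_right, mul_smul, Finset.smul_sum]
  have hLzero : ∀ t, L t 0 = 0 := by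
    intro t
    simp [hL]
  have hLneg : ∀ t x, L t (-x) = -L t x := by
    intro t x
    simp [hL, inner_neg_right]
  have hLsum : ∀ t {N : ℕ} (x : Fin N → EuclideanSpace ℝ (Fin n)),
      L t (∑ l, x l) = ∑ l, L t (x l) := by
    intro t N x
    simp only [hL, inner_sum, Finset.sum_smul]
    rw [Finset.sum_comm]
  have hL₀ : ∀ x, L t₀ x = x := fun x => (hon.eq_sum x).symm
  have hLe : ∀ t, L t (e₀ 0) = frenetVector α 0 t := by
    intro t
    simp only [hL]
    rw [Finset.sum_eq_single (⟨0, by omega⟩ : Fin n)]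
    · rw [hon.inner_nat (i := 0) (j := 0) (by omega) (by omega), if_pos rfl, one_smul]
    · intro l _ hl
      have hl' : (l : ℕ) ≠ 0 := fun e => hl (Fin.ext e)
      rw [hon.inner_nat l.2 (by omega), if_neg hl', zero_smul]
    · simp
  have hLd : ∀ x, ∀ t ∈ I, HasDerivAt (fun s => L s x) (‖deriv α t‖ • L t (T x)) t := by
    intro x t ht
    have h1 : HasDerivAt (fun s => L s x) (∑ i : Fin n, (inner ℝ (e₀ i) x : ℝ) •
        (‖deriv α t‖ • ∑ j : Fin n, frenetMatrix α i j t • frenetVector α j t)) t :=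
      HasDerivAt.fun_sum fun i _ => (S.frame t ht i i.2).const_smul (inner ℝ (e₀ i) x : ℝ)
    refine h1.congr_deriv ?_
    have h2 : ∀ j : Fin n, (inner ℝ (e₀ j) (T x) : ℝ) =
        ∑ i : Fin n, k i j * inner ℝ (e₀ i) x := by
      intro j
      rw [hTapp, inner_sum]
      refine Finset.sum_congr rfl fun i _ => ?_
      rw [inner_sum, Finset.sum_eq_single j]
      · rw [inner_smul_right, hon.inner_nat j.2 j.2, if_pos rfl, mul_one]
      · intro l _ hl
        have hl' : (j : ℕ) ≠ l := fun e => hl (Fin.ext e.symm)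
        rw [inner_smul_right, hon.inner_nat j.2 l.2, if_neg hl', mul_zero]
      · simp
    simp only [hL, h2, Finset.sum_smul, Finset.smul_sum]
    rw [Finset.sum_comm]
    refine Finset.sum_congr rfl fun j _ => Finset.sum_congr rfl fun i _ => ?_
    rw [hc.frenetMatrix_eq hF hn hI ht ht₀ i.2 j.2]
    simp only [smul_smul, hk]
    congr 1
    ring
  obtain ⟨K, m, ρ, g, v₀, hm, hinj, hρ, hg, hT0, hT1, hTv₀, hsum, hgv, hspan⟩ :=
    exists_skew_normal_form hskew hcyc
  have hwC : ContDiffOn ℝ (n - 1 : ℕ) (fun t => ‖deriv α t‖) I := by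
    have h1 : ContDiffOn ℝ (n - 1 : ℕ) (deriv α) I := by
      refine hF.1.deriv_of_isOpen hI ?_
      exact_mod_cast (by omega : n - 1 + 1 ≤ n)
    exact h1.norm ℝ fun t ht => norm_pos_iff.1 (hF.deriv_eq hn ht).1
  obtain ⟨φ, hφ₀, hφ, hφC⟩ := exists_primitive hI hIc hwC ht₀
  rw [show n - 1 + 1 = n by omega] at hφC
  have hP : ∀ l, ∀ t ∈ I, HasDerivAt (fun s => L s (g (l, 0)))
      (‖deriv α t‖ • m l • L t (g (l, 1))) t := by
    intro l t ht
    have := hLd (g (l, 0)) t ht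
    rwa [hT0, hLsmul] at this
  have hQ : ∀ l, ∀ t ∈ I, HasDerivAt (fun s => L s (g (l, 1)))
      (-(‖deriv α t‖ • m l • L t (g (l, 0)))) t := by
    intro l t ht
    have := hLd (g (l, 1)) t ht
    rwa [hT1, hLneg, hLsmul, smul_neg] at this
  have hLv₀ : ∀ t ∈ I, L t v₀ = v₀ := by
    intro t ht
    refine (eq_of_hasDerivAt_zero (g := fun s => L s v₀) hI hpre (fun s hs => ?_) ht ht₀).trans
      (hL₀ v₀)
    have := hLd v₀ s hs
    rwa [hTv₀, hLzero, smul_zero] at this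
  -- The tangent is `v₀ + ∑ ρ l • L t (g (l, 1))`, and `L t (g (l, 1))` is the derivative of `L t (g
  -- (l, 0))` divided by `‖α'‖ * m l`; hence the radii `ρ l / m l`.
  have hconst : ∀ t ∈ I, HasDerivAt
      (fun s => α s - (φ s • v₀ + ∑ l, (ρ l / m l) • L s (g (l, 0)))) 0 t := by
    intro t ht
    have h1 : HasDerivAt (fun s => ∑ l, (ρ l / m l) • L s (g (l, 0)))
        (∑ l, (ρ l / m l) • (‖deriv α t‖ • m l • L t (g (l, 1)))) t :=
      HasDerivAt.fun_sum fun l _ => (hP l t ht).const_smul (ρ l / m l)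
    refine ((S.hasDerivAt t ht).fun_sub (((hφ t ht).smul_const v₀).fun_add h1)).congr_deriv ?_
    have h2 : ∑ l, (ρ l / m l) • (‖deriv α t‖ • m l • L t (g (l, 1))) =
        ‖deriv α t‖ • ∑ l, ρ l • L t (g (l, 1)) := by
      rw [Finset.smul_sum]
      refine Finset.sum_congr rfl fun l _ => ?_
      have := (hm l).ne'
      simp only [smul_smul]
      congr 1
      field_simp
    have h3 : frenetVector α 0 t = v₀ + ∑ l, ρ l • L t (g (l, 1)) := by
      rw [← hLe t]
      conv_lhs => rw [hsum]
      rw [hLadd, hLsum, hLv₀ t ht]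
      simp only [hLsmul]
    rw [h2, ← smul_add, ← h3, sub_self]
  refine ⟨K, m, fun l => ρ l / m l, g, v₀,
    α t₀ - (φ t₀ • v₀ + ∑ l, (ρ l / m l) • L t₀ (g (l, 0))), φ, hm, hinj,
    fun l => div_pos (hρ l) (hm l), hg, hgv, hspan, hφC, fun t ht => ?_, fun t ht => ?_⟩
  · rw [(hφ t ht).deriv]
    exact (hF.deriv_eq hn ht).1
  · have h1 := eq_of_hasDerivAt_zero hI hpre hconst ht ht₀
    have h2 : ∀ l, (ρ l / m l * Real.cos (m l * φ t)) • g (l, 0) +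
        (ρ l / m l * Real.sin (m l * φ t)) • g (l, 1) = (ρ l / m l) • L t (g (l, 0)) := by
      intro l
      have := eq_of_rotation_equations hI hpre ht₀ hφ₀ hφ (hP l) (hQ l) ht
      simp only [hL₀] at this
      rw [this, smul_add, smul_smul, smul_smul]
    simp only [h2]
    rw [← h1]
    abel

end ConstantCurvatures

/-! ### Matching the explicit form with torus geodesics, by parity of the dimension. -/

section Classification

/-- The planes together with `v₀` span, so the dimension is `2 * K` if `v₀ = 0` and `2 * K + 1`
otherwise: parity detects whether there is a drift. -/
theorem exists_pair_basis {E : Type*} [NormedAddCommGroup E] [InnerProductSpace ℝ E] {K : ℕ}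
    {g : Fin K × Fin 2 → E} {v₀ : E} (hg : Orthonormal ℝ g)
    (hgv : ∀ p, inner ℝ (g p) v₀ = (0 : ℝ))
    (hspan : Submodule.span ℝ (insert v₀ (Set.range g)) = ⊤) :
    (v₀ = 0 ∧ ∃ b : OrthonormalBasis (Fin (2 * K)) ℝ E, ∀ p, b (pairEquiv K p) = g p) ∨
    (v₀ ≠ 0 ∧ ∃ b : OrthonormalBasis (Fin (2 * K + 1)) ℝ E,
      (∀ p, b (pairEquiv K p).castSucc = g p) ∧ ‖v₀‖ • b (Fin.last _) = v₀) := by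
  set h₀ : Fin (2 * K) → E := g ∘ (pairEquiv K).symm with hh₀
  have hon₀ : Orthonormal ℝ h₀ := hg.comp _ (pairEquiv K).symm.injective
  have hr₀ : Set.range h₀ = Set.range g := (pairEquiv K).symm.surjective.range_comp g
  by_cases hv : v₀ = 0
  · left
    refine ⟨hv, OrthonormalBasis.mk hon₀ ?_, fun p => ?_⟩
    · rw [hr₀, ← hspan, hv, Submodule.span_insert_zero]
    · simp [hh₀]
  · right
    refine ⟨hv, ?_⟩
    set h₁ : Fin (2 * K + 1) → E := Fin.snoc (α := fun _ => E) h₀ ((‖v₀‖⁻¹ : ℝ) • v₀) with hh₁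
    have hcast : ∀ j, h₁ (Fin.castSucc j) = h₀ j := fun j => by simp [hh₁]
    have hlast : h₁ (Fin.last _) = (‖v₀‖⁻¹ : ℝ) • v₀ := by simp [hh₁]
    have hperp : ∀ j, inner ℝ (h₀ j) ((‖v₀‖⁻¹ : ℝ) • v₀) = (0 : ℝ) := by
      intro j
      rw [inner_smul_right, hh₀, Function.comp_apply, hgv, mul_zero]
    have hon₁ : Orthonormal ℝ h₁ := by
      refine ⟨fun i => ?_, fun i j hij => ?_⟩
      · refine Fin.lastCases ?_ (fun i => ?_) i
        · rw [hlast]; exact norm_smul_inv_norm hv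
        · rw [hcast]; exact hon₀.1 i
      · change inner ℝ (h₁ i) (h₁ j) = 0
        revert hij
        refine Fin.lastCases ?_ (fun i => ?_) i <;> refine Fin.lastCases ?_ (fun j => ?_) j
        · exact fun h => absurd rfl h
        · intro _
          rw [hlast, hcast, real_inner_comm]
          exact hperp j
        · intro _
          rw [hlast, hcast]
          exact hperp i
        · intro hij
          rw [hcast, hcast]
          exact hon₀.2 fun e => hij (by rw [e])
    have hvm : ‖v₀‖ • h₁ (Fin.last _) = v₀ := by
      rw [hlast, smul_smul, mul_inv_cancel₀ (norm_ne_zero_iff.2 hv), one_smul]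
    refine ⟨OrthonormalBasis.mk hon₁ ?_, fun p => ?_, ?_⟩
    · rw [← hspan, Submodule.span_le]
      rintro x (rfl | ⟨p, rfl⟩)
      · rw [← hvm]
        exact Submodule.smul_mem _ _ (Submodule.subset_span ⟨_, rfl⟩)
      · refine Submodule.subset_span ⟨(pairEquiv K p).castSucc, ?_⟩
        rw [hcast]
        simp [hh₀]
    · rw [OrthonormalBasis.coe_mk, hcast]
      simp [hh₀]
    · rw [OrthonormalBasis.coe_mk, hvm]

theorem exists_affineIsometry_eq {n : ℕ}
    (b : OrthonormalBasis (Fin n) ℝ (EuclideanSpace ℝ (Fin n))) (C : EuclideanSpace ℝ (Fin n)) :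
    ∃ A : EuclideanSpace ℝ (Fin n) ≃ᵃⁱ[ℝ] EuclideanSpace ℝ (Fin n),
      ∀ x, A x = C + ∑ j, x j • b j := by
  refine ⟨b.repr.symm.toAffineIsometryEquiv.trans (AffineIsometryEquiv.constVAdd ℝ _ C),
    fun x => ?_⟩
  simp [b.sum_repr_symm]

variable {k : ℕ} {I : Set ℝ}

theorem IsTwistedCurve.exists_geodesic_even (hk : 1 ≤ k) (hIo : IsOpen I) (hIc : I.OrdConnected)
    (hIn : I.Nonempty) {α : ℝ → EuclideanSpace ℝ (Fin (2 * k))} (hα : IsTwistedCurve α I)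
    (hc : HasConstantCurvatures α I) : ∃ γ : ℝ → EuclideanSpace ℝ (Fin (2 * k)),
      IsFlatTorusGeodesic γ ∧ IsTwistedCurve γ Set.univ ∧ IsCongruentReparam α γ I := by
  obtain ⟨K, m, r, g, v₀, C, φ, hm, hinj, hr, hg, hgv, hspan, hφ, hφpos, hform⟩ :=
    hα.exists_explicit_form (by omega) hIo hIc hIn hc
  rcases exists_pair_basis hg hgv hspan with ⟨rfl, b, hb⟩ | ⟨-, b, -⟩
  · have hdim := Module.finrank_eq_card_basis b.toBasis
    simp only [finrank_euclideanSpace, Fintype.card_fin] at hdim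
    obtain rfl : K = k := by omega
    obtain ⟨A, hA⟩ := exists_affineIsometry_eq b C
    -- The phases are zero because the isometry `A`, built from the adapted basis `b`, absorbs them.
    refine ⟨fun t => flatTorus r (fun l => m l * t + (0 : Fin K → ℝ) l), ⟨r, m, 0, hr, fun _ => rfl⟩,
      isTwistedCurve_flatTorus hk hr hm hinj, A, φ, hφ, hφpos, fun t ht => ?_⟩
    rw [hform t ht, hA, sum_pairs]
    simp only [flatTorus_even, flatTorus_odd, hb, Pi.zero_apply, add_zero, smul_zero, zero_add]
  · have hdim := Module.finrank_eq_card_basis b.toBasis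
    simp only [finrank_euclideanSpace, Fintype.card_fin] at hdim
    omega

theorem IsTwistedCurve.exists_geodesic_odd (hk : 1 ≤ k) (hIo : IsOpen I) (hIc : I.OrdConnected)
    (hIn : I.Nonempty) {α : ℝ → EuclideanSpace ℝ (Fin (2 * k + 1))} (hα : IsTwistedCurve α I)
    (hc : HasConstantCurvatures α I) : ∃ (γ : ℝ → EuclideanSpace ℝ (Fin (2 * k))) (a : ℝ),
      IsFlatTorusGeodesic γ ∧ IsTwistedCurve γ Set.univ ∧ a ≠ 0 ∧
        IsCongruentReparam α (timesLinear γ a) I := by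
  obtain ⟨K, m, r, g, v₀, C, φ, hm, hinj, hr, hg, hgv, hspan, hφ, hφpos, hform⟩ :=
    hα.exists_explicit_form (by omega) hIo hIc hIn hc
  rcases exists_pair_basis hg hgv hspan with ⟨-, b, -⟩ | ⟨hv, b, hb, hbv⟩
  · have hdim := Module.finrank_eq_card_basis b.toBasis
    simp only [finrank_euclideanSpace, Fintype.card_fin] at hdim
    omega
  · have hdim := Module.finrank_eq_card_basis b.toBasis
    simp only [finrank_euclideanSpace, Fintype.card_fin] at hdim
    obtain rfl : K = k := by omega
    obtain ⟨A, hA⟩ := exists_affineIsometry_eq b C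
    -- The slope `a` is `‖v₀‖`, because the last basis vector is `v₀` normalized.
    refine ⟨fun t => flatTorus r (fun l => m l * t + (0 : Fin K → ℝ) l), ‖v₀‖,
      ⟨r, m, 0, hr, fun _ => rfl⟩, isTwistedCurve_flatTorus hk hr hm hinj, norm_ne_zero_iff.2 hv,
      A, φ, hφ, hφpos, fun t ht => ?_⟩
    rw [hform t ht, hA, Fin.sum_univ_castSucc, sum_pairs]
    simp only [timesLinear, Fin.snoc_castSucc, Fin.snoc_last, flatTorus_even, flatTorus_odd, hb,
      Pi.zero_apply, add_zero]
    rw [mul_comm ‖v₀‖ (φ t), mul_smul, hbv, add_comm (φ t • v₀)]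

end Classification

end

theorem mainTheorem2 (k : ℕ) (hk : 1 ≤ k) (I : Set ℝ) (hIo : IsOpen I) (hIc : I.OrdConnected)
    (hIn : I.Nonempty) :
    (∀ α : ℝ → EuclideanSpace ℝ (Fin (2 * k)),
      (IsTwistedCurve α I ∧ HasConstantCurvatures α I) ↔
        ∃ γ : ℝ → EuclideanSpace ℝ (Fin (2 * k)),
          IsFlatTorusGeodesic γ ∧ IsTwistedCurve γ Set.univ ∧ IsCongruentReparam α γ I) ∧
    (∀ α : ℝ → EuclideanSpace ℝ (Fin (2 * k + 1)),
      (IsTwistedCurve α I ∧ HasConstantCurvatures α I) ↔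
        ∃ (γ : ℝ → EuclideanSpace ℝ (Fin (2 * k))) (a : ℝ),
          IsFlatTorusGeodesic γ ∧ IsTwistedCurve γ Set.univ ∧ a ≠ 0 ∧
            IsCongruentReparam α (timesLinear γ a) I) := by
  have hpre : IsPreconnected I := hIc.isPreconnected
  refine ⟨fun α => ⟨fun h => h.1.exists_geodesic_even hk hIo hIc hIn h.2, ?_⟩,
    fun α => ⟨fun h => h.1.exists_geodesic_odd hk hIo hIc hIn h.2, ?_⟩⟩
  · rintro ⟨γ, hγ, hT, hcong⟩
    exact hcong.isTwistedCurve (by omega) hIo hpre hT (hγ.hasConstantCurvatures hk hT.1)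
  · rintro ⟨γ, a, hγ, hT, ha, hcong⟩
    obtain ⟨hT', hc⟩ := hγ.timesLinear hk hT ha
    exact hcong.isTwistedCurve (by omega) hIo hpre hT' hc
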